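/- Let $G$ be a (finite-dimensional, Hausdorff, second countable) real Lie group with identity $e$, let $X_1,\dots,X_d$ be a basis of its left-invariant vector fields, and let functions be $\mathbb K$-valued with $\mathbb K=\mathbb R$ or $\mathbb C$. Let $C_b^2(G)$ be the space of $f\in C^2(G)$ with $$\|f\|_{C^2}=\max_{|\alpha|\le 2}\|X^\alpha f\|_\infty<\infty ,$$ where $X^\alpha$ runs over all products of at most two of the fields $X_j$ (the identity, $X_j$, and $X_jX_k$). A distribution $P$ on $G$ (a $\mathbb K$-linear functional on $C_c^\infty(G)$, continuous in the usual sense) is called *dissipative* if $\langle P,f\rangle$ is real and $\langle P,f\rangle\le 0$ for every real $f\in C_c^\infty(G)$ that attains its maximal value at $e$. Every dissipative distribution $P$ has exactly one extension to a continuous linear functional on $C_b^2(G)$, again denoted by $P$, for which there is a positive measure $\nu$ on $G\setminus\{e\}$, finite outside every open neighbourhood of $e$, such that every $f\in C_b^2(G)$ with $f(e)=X_jf(e)=X_jX_kf(e)=0$ for all $1\le j,k\le d$ is $\nu$-integrable and satisfies $\langle P,f\rangle=\int f\,d\nu$. Let $\|P\|$ be the norm of this functional on $(C_b^2(G),\|\cdot\|_{C^2})$.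 Let $\Phi_1,\dots,\Phi_d\in C_c^\infty(G)$ be real functions with $\Phi_k(e)=0$ and $X_j\Phi_k(e)=\delta_{jk}$ for $1\le j,k\le d$, and put $\Phi_{jk}=\Phi_j\Phi_k$. Let $\Phi\in C_c^\infty(G)$ be a $[0,1]$-valued function that equals $1-\sum_{k=1}^d\Phi_k^2$ in a neighbourhood of $e$ and satisfies $\Phi(x)<1$ for all $x\ne e$. Then there is a constant $C>0$, depending only on $G$, $\mathbb K$, the $X_j$, the $\Phi_j$ and $\Phi$, such that for every dissipative distribution $P$ on $G$ $$\|P\|\le C\Big(|\langle P,\Phi\rangle|+\sum_{j,k=1}^d|\langle P,\Phi_{jk}\rangle|+\sum_{j=1}^d|\langle P,\Phi_j\rangle|+|\langle P,1\rangle|\Big).$$ -/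

import Mathlib

open scoped Manifold ContDiff

noncomputable section

namespace LieDissipative

section Definitions

variable {E : Type*} [NormedAddCommGroup E] [NormedSpace ℝ E]
  {G : Type*} [TopologicalSpace G] [ChartedSpace E G] [Group G]
  {𝕜 : Type*} [RCLike 𝕜] {d : ℕ}

/-- The derivative `X f` of a scalar function `f` along the left-invariant vector field `X` on `G`
whose value at the identity is `v`. -/
def lieDeriv (v : GroupLieAlgebra 𝓘(ℝ, E) G) (f : G → 𝕜) : G → 𝕜 :=
  fun g => mfderiv 𝓘(ℝ, E) 𝓘(ℝ, 𝕜) f g (mulInvariantVectorField v g)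

/-- The iterated derivative `X_{j₁} (X_{j₂} (⋯ (X_{jₘ} f)))` along the word `[j₁, …, jₘ]`. -/
def iterLieDeriv (b : Module.Basis (Fin d) ℝ (GroupLieAlgebra 𝓘(ℝ, E) G)) :
    List (Fin d) → (G → 𝕜) → (G → 𝕜)
  | [], f => f
  | j :: w, f => lieDeriv (b j) (iterLieDeriv b w f)

/-! ### Calculus facts needed for the definitions -/

lemma lieDeriv_add (v : GroupLieAlgebra 𝓘(ℝ, E) G) {f g : G → 𝕜}
    (hf : ContMDiff 𝓘(ℝ, E) 𝓘(ℝ, 𝕜) 1 f) (hg : ContMDiff 𝓘(ℝ, E) 𝓘(ℝ, 𝕜) 1 g) :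
    lieDeriv v (f + g) = lieDeriv v f + lieDeriv v g := by
  funext x
  have h := mfderiv_add (hf.mdifferentiable one_ne_zero x)
    (hg.mdifferentiable one_ne_zero x)
  have h2 := DFunLike.congr_fun h (mulInvariantVectorField v x)
  exact h2

lemma lieDeriv_const (v : GroupLieAlgebra 𝓘(ℝ, E) G) (c : 𝕜) :
    lieDeriv v (fun _ : G => c) = fun _ => 0 := by
  funext x
  have h : mfderiv 𝓘(ℝ, E) 𝓘(ℝ, 𝕜) (fun _ : G => c) x = 0 := mfderiv_const
  exact DFunLike.congr_fun h (mulInvariantVectorField v x)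

lemma lieDeriv_smul (v : GroupLieAlgebra 𝓘(ℝ, E) G) (c : 𝕜) {f : G → 𝕜}
    (hf : ContMDiff 𝓘(ℝ, E) 𝓘(ℝ, 𝕜) 1 f) :
    lieDeriv v (c • f) = c • lieDeriv v f := by
  funext x
  have hd := (hf.mdifferentiable one_ne_zero x).hasMFDerivAt
  have hL : HasMFDerivAt 𝓘(ℝ, 𝕜) 𝓘(ℝ, 𝕜) (fun y : 𝕜 => c • y) (f x)
      (c • ContinuousLinearMap.id ℝ 𝕜) :=
    ((hasFDerivAt_id (𝕜 := ℝ) (f x)).const_smul c).hasMFDerivAt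
  have h := (hL.comp x hd).mfderiv
  exact DFunLike.congr_fun h (mulInvariantVectorField v x)

lemma hasCompactSupport_lieDeriv (v : GroupLieAlgebra 𝓘(ℝ, E) G) {f : G → 𝕜}
    (hf : HasCompactSupport f) : HasCompactSupport (lieDeriv v f) := by
  refine hf.mono' fun x hx => ?_
  by_contra hx'
  apply hx
  have h0 : f =ᶠ[nhds x] fun _ => (0 : 𝕜) := notMem_tsupport_iff_eventuallyEq.1 hx'
  have h1 : mfderiv 𝓘(ℝ, E) 𝓘(ℝ, 𝕜) f x = 0 :=
    ((hasMFDerivAt_const (0 : 𝕜) x).congr_of_eventuallyEq h0).mfderiv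
  exact DFunLike.congr_fun h1 (mulInvariantVectorField v x)

lemma contMDiff_lieDeriv [LieGroup 𝓘(ℝ, E) ∞ G] (v : GroupLieAlgebra 𝓘(ℝ, E) G) {f : G → 𝕜}
    {m n : WithTop ℕ∞} (hm : m ≤ 2) (hmn : m + 1 ≤ n)
    (hf : ContMDiff 𝓘(ℝ, E) 𝓘(ℝ, 𝕜) n f) :
    ContMDiff 𝓘(ℝ, E) 𝓘(ℝ, 𝕜) m (lieDeriv v f) := by
  have h3 : minSmoothness ℝ 3 ≤ (∞ : WithTop ℕ∞) := by
    rw [minSmoothness_of_isRCLikeNormedField]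
    exact WithTop.coe_le_coe.2 le_top
  have : LieGroup 𝓘(ℝ, E) (minSmoothness ℝ 3) G := LieGroup.of_le h3
  have h2 : m ≤ minSmoothness ℝ 2 := by
    rw [minSmoothness_of_isRCLikeNormedField]
    exact hm
  have hT := (hf.contMDiff_tangentMap hmn).comp
    ((contMDiff_mulInvariantVectorField v).of_le h2)
  exact (contMDiff_snd_tangentBundle_modelSpace 𝕜 𝓘(ℝ, 𝕜)).comp hT

lemma contMDiff_iterLieDeriv [LieGroup 𝓘(ℝ, E) ∞ G]
    (b : Module.Basis (Fin d) ℝ (GroupLieAlgebra 𝓘(ℝ, E) G)) {f : G → 𝕜}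
    (hf : ContMDiff 𝓘(ℝ, E) 𝓘(ℝ, 𝕜) 2 f) (w : List (Fin d)) (k : ℕ) (hk : k + w.length ≤ 2) :
    ContMDiff 𝓘(ℝ, E) 𝓘(ℝ, 𝕜) k (iterLieDeriv b w f) := by
  induction w generalizing k with
  | nil => exact hf.of_le (by exact_mod_cast hk)
  | cons j w ih =>
    simp only [List.length_cons] at hk
    have h1 := ih (k + 1) (by omega)
    refine contMDiff_lieDeriv (n := ((k + 1 : ℕ) : WithTop ℕ∞)) (b j) ?_ ?_ h1
    · exact_mod_cast (show k ≤ 2 by omega)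
    · push_cast; exact le_rfl

lemma iterLieDeriv_add [LieGroup 𝓘(ℝ, E) ∞ G]
    (b : Module.Basis (Fin d) ℝ (GroupLieAlgebra 𝓘(ℝ, E) G)) {f g : G → 𝕜}
    (hf : ContMDiff 𝓘(ℝ, E) 𝓘(ℝ, 𝕜) 2 f) (hg : ContMDiff 𝓘(ℝ, E) 𝓘(ℝ, 𝕜) 2 g)
    (w : List (Fin d)) (hw : w.length ≤ 2) :
    iterLieDeriv b w (f + g) = iterLieDeriv b w f + iterLieDeriv b w g := by
  induction w with
  | nil => rfl
  | cons j w ih =>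
    simp only [List.length_cons] at hw
    have h1 := contMDiff_iterLieDeriv b hf w 1 (by omega)
    have h2 := contMDiff_iterLieDeriv b hg w 1 (by omega)
    simp only [iterLieDeriv]
    rw [ih (by omega)]
    exact lieDeriv_add (b j) (by exact_mod_cast h1) (by exact_mod_cast h2)

lemma iterLieDeriv_smul [LieGroup 𝓘(ℝ, E) ∞ G]
    (b : Module.Basis (Fin d) ℝ (GroupLieAlgebra 𝓘(ℝ, E) G)) (c : 𝕜) {f : G → 𝕜}
    (hf : ContMDiff 𝓘(ℝ, E) 𝓘(ℝ, 𝕜) 2 f) (w : List (Fin d)) (hw : w.length ≤ 2) :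
    iterLieDeriv b w (c • f) = c • iterLieDeriv b w f := by
  induction w with
  | nil => rfl
  | cons j w ih =>
    simp only [List.length_cons] at hw
    have h1 := contMDiff_iterLieDeriv b hf w 1 (by omega)
    simp only [iterLieDeriv]
    rw [ih (by omega)]
    exact lieDeriv_smul (b j) c (by exact_mod_cast h1)

lemma iterLieDeriv_zero (b : Module.Basis (Fin d) ℝ (GroupLieAlgebra 𝓘(ℝ, E) G))
    (w : List (Fin d)) : iterLieDeriv b w (fun _ : G => (0 : 𝕜)) = fun _ => 0 := by
  induction w with
  | nil => rfl
  | cons j w ih => simp only [iterLieDeriv, ih, lieDeriv_const]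

lemma norm_iterLieDeriv_const_le (b : Module.Basis (Fin d) ℝ (GroupLieAlgebra 𝓘(ℝ, E) G))
    (c : 𝕜) (w : List (Fin d)) (x : G) : ‖iterLieDeriv b w (fun _ : G => c) x‖ ≤ ‖c‖ := by
  cases w with
  | nil => exact le_rfl
  | cons j w =>
    have h : iterLieDeriv b (j :: w) (fun _ : G => c) = fun _ => 0 := by
      induction w generalizing j with
      | nil => exact lieDeriv_const (b j) c
      | cons i w ih => rw [iterLieDeriv, ih i, lieDeriv_const]
    rw [h]
    simp

lemma hasCompactSupport_iterLieDeriv (b : Module.Basis (Fin d) ℝ (GroupLieAlgebra 𝓘(ℝ, E) G))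
    {f : G → 𝕜} (hf : HasCompactSupport f) (w : List (Fin d)) :
    HasCompactSupport (iterLieDeriv b w f) := by
  induction w with
  | nil => exact hf
  | cons j w ih => exact hasCompactSupport_lieDeriv (b j) ih

/-! ### The Banach space of `C²` functions with bounded derivatives -/

section CbTwo

variable [LieGroup 𝓘(ℝ, E) ∞ G]

variable (𝕜) in
/-- The functions `f` of class `C²` on `G` such that `f`, all `X_j f` and all `X_j X_k f` are
bounded, as a subspace of the space of all functions. -/
def cbTwoSubmodule (b : Module.Basis (Fin d) ℝ (GroupLieAlgebra 𝓘(ℝ, E) G)) :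
    Submodule 𝕜 (G → 𝕜) where
  carrier := {f | ContMDiff 𝓘(ℝ, E) 𝓘(ℝ, 𝕜) 2 f ∧
    ∃ M : ℝ, ∀ w : List (Fin d), w.length ≤ 2 → ∀ x, ‖iterLieDeriv b w f x‖ ≤ M}
  add_mem' := by
    rintro f g ⟨hf, M, hM⟩ ⟨hg, N, hN⟩
    refine ⟨hf.add hg, M + N, fun w hw x => ?_⟩
    rw [iterLieDeriv_add b hf hg w hw]
    exact (norm_add_le _ _).trans (add_le_add (hM w hw x) (hN w hw x))
  zero_mem' := by
    refine ⟨contMDiff_const, ‖(0 : 𝕜)‖, fun w _ x => norm_iterLieDeriv_const_le b 0 w x⟩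
  smul_mem' := by
    rintro c f ⟨hf, M, hM⟩
    refine ⟨?_, ‖c‖ * M, fun w hw x => ?_⟩
    · have hc : ContDiff ℝ 2 (fun y : 𝕜 => c • y) := contDiff_id.const_smul c
      exact hc.contMDiff.comp hf
    · rw [iterLieDeriv_smul b c hf w hw, Pi.smul_apply, norm_smul]
      exact mul_le_mul_of_nonneg_left (hM w hw x) (norm_nonneg c)

variable (𝕜) in
/-- The space `C_b²(G)`, normed below by the largest of the supremum norms of
`f`, `X_j f`, `X_j X_k f`. -/
def CbTwo (b : Module.Basis (Fin d) ℝ (GroupLieAlgebra 𝓘(ℝ, E) G)) : Type _ :=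
  ↥(cbTwoSubmodule 𝕜 b)

namespace CbTwo

variable {b : Module.Basis (Fin d) ℝ (GroupLieAlgebra 𝓘(ℝ, E) G)}

instance : AddCommGroup (CbTwo 𝕜 b) := inferInstanceAs (AddCommGroup ↥(cbTwoSubmodule 𝕜 b))

instance : Module 𝕜 (CbTwo 𝕜 b) := inferInstanceAs (Module 𝕜 ↥(cbTwoSubmodule 𝕜 b))

instance : CoeFun (CbTwo 𝕜 b) (fun _ => G → 𝕜) := ⟨fun f => f.1⟩

/-- The norm of `C_b²(G)`: the supremum of `|X^w f(x)|` over all words `w` of length at most two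
and all points `x`. -/
instance : Norm (CbTwo 𝕜 b) :=
  ⟨fun f => ⨆ p : {w : List (Fin d) // w.length ≤ 2} × G, ‖iterLieDeriv b p.1.1 f p.2‖⟩

lemma norm_def (f : CbTwo 𝕜 b) :
    ‖f‖ = ⨆ p : {w : List (Fin d) // w.length ≤ 2} × G, ‖iterLieDeriv b p.1.1 f p.2‖ := rfl

lemma norm_iterLieDeriv_le (f : CbTwo 𝕜 b) (w : List (Fin d)) (hw : w.length ≤ 2) (x : G) :
    ‖iterLieDeriv b w f x‖ ≤ ‖f‖ := by
  obtain ⟨M, hM⟩ := f.2.2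
  have hB : BddAbove (Set.range fun p : {w : List (Fin d) // w.length ≤ 2} × G =>
      ‖iterLieDeriv b p.1.1 f p.2‖) := ⟨M, by rintro _ ⟨p, rfl⟩; exact hM p.1.1 p.1.2 p.2⟩
  exact le_ciSup hB (⟨w, hw⟩, x)

lemma norm_le_of_forall (f : CbTwo 𝕜 b) {M : ℝ}
    (h : ∀ w : List (Fin d), w.length ≤ 2 → ∀ x, ‖iterLieDeriv b w f x‖ ≤ M) : ‖f‖ ≤ M := by
  have : Nonempty ({w : List (Fin d) // w.length ≤ 2} × G) := ⟨(⟨[], by simp⟩, 1)⟩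
  exact ciSup_le fun p => h p.1.1 p.1.2 p.2

lemma norm_smul_le' (c : 𝕜) (f : CbTwo 𝕜 b) : ‖c • f‖ ≤ ‖c‖ * ‖f‖ := by
  refine norm_le_of_forall _ fun w hw x => ?_
  have h : iterLieDeriv b w (c • f : CbTwo 𝕜 b) = c • iterLieDeriv b w f :=
    iterLieDeriv_smul b c f.2.1 w hw
  rw [h, Pi.smul_apply, norm_smul]
  exact mul_le_mul_of_nonneg_left (norm_iterLieDeriv_le f w hw x) (norm_nonneg c)

instance : NormedAddCommGroup (CbTwo 𝕜 b) :=
  AddGroupNorm.toNormedAddCommGroup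
    { toFun := fun f => ‖f‖
      map_zero' := le_antisymm
        (norm_le_of_forall _ fun w _ x =>
          (norm_iterLieDeriv_const_le b (0 : 𝕜) w x).trans norm_zero.le)
        ((norm_nonneg _).trans (norm_iterLieDeriv_le (0 : CbTwo 𝕜 b) [] (by simp) 1))
      add_le' := fun f g => norm_le_of_forall _ fun w hw x => by
        have h : iterLieDeriv b w (f + g : CbTwo 𝕜 b)
            = iterLieDeriv b w f + iterLieDeriv b w g :=
          iterLieDeriv_add b f.2.1 g.2.1 w hw
        rw [h]
        exact (norm_add_le _ _).trans
          (add_le_add (norm_iterLieDeriv_le f w hw x) (norm_iterLieDeriv_le g w hw x))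
      neg' := by
        have key : ∀ f : CbTwo 𝕜 b, ‖-f‖ ≤ ‖f‖ := fun f => by
          have h := norm_smul_le' (-1 : 𝕜) f
          simpa using h
        exact fun f => le_antisymm (key f) (by simpa using key (-f))
      eq_zero_of_map_eq_zero' := fun f hf => by
        have hf' : ‖f‖ = 0 := hf
        refine Subtype.ext (funext fun x => ?_)
        have h := norm_iterLieDeriv_le f [] (by simp) x
        rw [hf'] at h
        exact norm_le_zero_iff.1 h }

instance : NormedSpace 𝕜 (CbTwo 𝕜 b) where
  norm_smul_le := norm_smul_le'

/-- The constant function `1` as an element of `C_b²(G)`. -/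
instance : One (CbTwo 𝕜 b) :=
  ⟨⟨fun _ => 1, contMDiff_const, ‖(1 : 𝕜)‖, fun w _ x => norm_iterLieDeriv_const_le b 1 w x⟩⟩

end CbTwo

end CbTwo

/-! ### Test functions and dissipative distributions -/

variable (E G 𝕜) in
/-- Smooth compactly supported functions, as a subspace of the space of all functions. -/
def testFunSubmodule : Submodule 𝕜 (G → 𝕜) where
  carrier := {f | ContMDiff 𝓘(ℝ, E) 𝓘(ℝ, 𝕜) ∞ f ∧ HasCompactSupport f}
  add_mem' := fun hf hg => ⟨hf.1.add hg.1, hf.2.add hg.2⟩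
  zero_mem' := ⟨contMDiff_const, HasCompactSupport.zero⟩
  smul_mem' := fun c f hf => by
    refine ⟨?_, hf.2.smul_left (f := fun _ => c)⟩
    have hc : ContDiff ℝ ∞ (fun y : 𝕜 => c • y) := contDiff_id.const_smul c
    exact hc.contMDiff.comp hf.1

variable (E G 𝕜) in
/-- The space `C_c^∞(G)` of `𝕜`-valued test functions. -/
def TestFun : Type _ := ↥(testFunSubmodule E G 𝕜)

namespace TestFun

instance : AddCommGroup (TestFun E G 𝕜) := inferInstanceAs (AddCommGroup ↥(testFunSubmodule E G 𝕜))

instance : Module 𝕜 (TestFun E G 𝕜) := inferInstanceAs (Module 𝕜 ↥(testFunSubmodule E G 𝕜))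

instance : CoeFun (TestFun E G 𝕜) (fun _ => G → 𝕜) := ⟨fun f => f.1⟩

/-- The pointwise product of test functions. -/
instance : Mul (TestFun E G 𝕜) :=
  ⟨fun f g => ⟨fun x => f x * g x, by
    have hm : ContDiff ℝ ∞ (fun p : 𝕜 × 𝕜 => p.1 * p.2) := contDiff_mul
    exact hm.contMDiff.comp (f.2.1.prodMk_space g.2.1), f.2.2.mul_right⟩⟩

variable (𝕜) in
/-- A real test function regarded as a `𝕜`-valued one. -/
def ofReal (f : TestFun E G ℝ) : TestFun E G 𝕜 :=
  ⟨fun x => (f x : 𝕜), (RCLike.ofRealCLM (K := 𝕜)).contDiff.contMDiff.comp f.2.1,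
    f.2.2.comp_left (g := fun r : ℝ => (r : 𝕜)) RCLike.ofReal_zero⟩

/-- The inclusion of `C_c^∞(G)` in `C_b²(G)`. -/
def toCbTwo [LieGroup 𝓘(ℝ, E) ∞ G] (b : Module.Basis (Fin d) ℝ (GroupLieAlgebra 𝓘(ℝ, E) G))
    (f : TestFun E G 𝕜) : CbTwo 𝕜 b :=
  ⟨f.1, f.2.1.of_le (WithTop.coe_le_coe.2 le_top), by
    have hf2 : ContMDiff 𝓘(ℝ, E) 𝓘(ℝ, 𝕜) 2 f.1 := f.2.1.of_le (WithTop.coe_le_coe.2 le_top)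
    have hb : ∀ w : List (Fin d), ∃ M : ℝ, w.length ≤ 2 → ∀ x, ‖iterLieDeriv b w f.1 x‖ ≤ M := by
      intro w
      by_cases hw : w.length ≤ 2
      · obtain ⟨M, hM⟩ := (hasCompactSupport_iterLieDeriv b f.2.2 w).exists_bound_of_continuous
          (contMDiff_iterLieDeriv b hf2 w 0 (by omega)).continuous
        exact ⟨M, fun _ => hM⟩
      · exact ⟨0, fun h => absurd h hw⟩
    choose M hM using hb
    obtain ⟨N, hN⟩ := ((List.finite_length_le (Fin d) 2).image M).bddAbove
    exact ⟨N, fun w hw x => (hM w hw x).trans (hN ⟨w, hw, rfl⟩)⟩⟩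

end TestFun

/-- A linear functional on `C_c^∞(G)` is a Schwartz distribution if on the test functions supported
in a given compact set it is bounded by finitely many of the seminorms `sup |X^w f|`. -/
def IsDistribution (b : Module.Basis (Fin d) ℝ (GroupLieAlgebra 𝓘(ℝ, E) G))
    (P : TestFun E G 𝕜 →ₗ[𝕜] 𝕜) : Prop :=
  ∀ K : Set G, IsCompact K → ∃ (m : ℕ) (C : ℝ), ∀ f : TestFun E G 𝕜, tsupport f ⊆ K →
    ∀ M : ℝ, (∀ w : List (Fin d), w.length ≤ m → ∀ x, ‖iterLieDeriv b w f x‖ ≤ M) →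
      ‖P f‖ ≤ C * M

/-- A distribution `P` is dissipative if `⟨P, f⟩` is a nonpositive real number for every real test
function `f` which attains its maximal value at the identity. -/
structure IsDissipative (b : Module.Basis (Fin d) ℝ (GroupLieAlgebra 𝓘(ℝ, E) G))
    (P : TestFun E G 𝕜 →ₗ[𝕜] 𝕜) : Prop where
  isDistribution : IsDistribution b P
  nonpos : ∀ f : TestFun E G ℝ, (∀ x, f x ≤ f 1) →
    RCLike.re (P (f.ofReal 𝕜)) ≤ 0 ∧ RCLike.im (P (f.ofReal 𝕜)) = 0

/-- `Q` is the extension of the distribution `P` to a continuous linear functional on `C_b²(G)`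
given by the Lévy measure: there is a positive measure `ν` on `G ∖ {e}` (regarded as a measure on
`G` without mass at `e`), finite outside every neighbourhood of `e`, such that
`⟨Q, f⟩ = ∫ f dν` for all `f` in `C_b²(G)` with `f(e) = X_j f(e) = X_j X_k f(e) = 0`. -/
structure IsLevyExtension [LieGroup 𝓘(ℝ, E) ∞ G] [MeasurableSpace G]
    (b : Module.Basis (Fin d) ℝ (GroupLieAlgebra 𝓘(ℝ, E) G))
    (P : TestFun E G 𝕜 →ₗ[𝕜] 𝕜) (Q : CbTwo 𝕜 b →L[𝕜] 𝕜) : Prop where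
  extends_test : ∀ f : TestFun E G 𝕜, Q (f.toCbTwo b) = P f
  levy : ∃ ν : MeasureTheory.Measure G, ν {1} = 0 ∧
    (∀ U : Set G, IsOpen U → 1 ∈ U → ν Uᶜ < ⊤) ∧
    ∀ f : CbTwo 𝕜 b, f 1 = 0 → (∀ j, lieDeriv (b j) f 1 = 0) →
      (∀ j k, lieDeriv (b j) (lieDeriv (b k) f) 1 = 0) →
      MeasureTheory.Integrable f ν ∧ Q f = ∫ x, f x ∂ν

/-- Real test functions `φ_1, …, φ_d` that are local coordinates at the identity adapted to the
basis `X_1, …, X_d`. -/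
structure IsCoordinateSystem (b : Module.Basis (Fin d) ℝ (GroupLieAlgebra 𝓘(ℝ, E) G))
    (φ : Fin d → TestFun E G ℝ) : Prop where
  apply_one : ∀ k, φ k 1 = 0
  lieDeriv_one : ∀ j k, lieDeriv (b j) (φ k) 1 = if j = k then 1 else 0

/-- A cutoff `Φ` such that `1 - Φ` is a Hunt function for the coordinates `φ_1, …, φ_d`. -/
structure IsHuntCutoff (φ : Fin d → TestFun E G ℝ) (Φ : TestFun E G ℝ) : Prop where
  nonneg : ∀ x, 0 ≤ Φ x
  le_one : ∀ x, Φ x ≤ 1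
  eq_near_one : ∀ᶠ x in nhds (1 : G), Φ x = 1 - ∑ k, φ k x ^ 2
  lt_one : ∀ x, x ≠ 1 → Φ x < 1

end Definitions

end LieDissipative

end

/-!
Write `H = 1 - Φ` for the Hunt function: it vanishes only at the identity, is comparable there to
the squared distance, and equals `1` off the support of `Φ`. Let `P` be dissipative.

*The Lévy measure.* If `u ≥ 0` then `H u` is nonnegative and vanishes at the identity, so
`u ↦ ⟨P, H u⟩` is a positive functional on the space of those continuous compactly supported `u`
for which `H u` is smooth. It extends to a positive functional on all of `C_c(G)` by the theorem of
M. Riesz on positive extensions, and so it is given by a measure `μ`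
(`IsDissipative.exists_measure`). For `u ≤ 1` the function `H u + Φ` attains its maximum `1` at the
identity; hence the mass of `μ` is at most `|⟨P, Φ⟩|`. The Lévy measure is `ν = H⁻¹ μ` on the
complement of the identity. If the test function `h` vanishes to second order at the identity, then
`h / H` is continuous, whence `⟨P, h⟩ = ∫ h dν` (`IsDissipative.eq_integral`).

*The extension.* Every `f` in `C_b²(G)` is the sum of a test function `T f`, a combination of
`Φ`, `φ_j`, `φ_j φ_k` with coefficients bounded by the norm of `f`, and of a remainder `R f` that
vanishes to second order at the identity. Two applications of the mean value inequality in a chart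
give `|R f| ≤ K ‖f‖ H` (`exists_norm_le_hunt`), so that `⟨Q, f⟩ = ⟨P, T f⟩ + ∫ R f dν` defines the
extension, and both terms are bounded in terms of `|⟨P, Φ⟩|`, `|⟨P, φ_j⟩|` and `|⟨P, φ_j φ_k⟩|`
(`exists_levyExtension_norm_le`).

*Uniqueness.* Any extension has this form with its own Lévy measure, and `P` determines that measure
through test functions supported away from the identity (`measure_eq_of_integral_testFun_eq`).

A dissipative distribution need not be real on real functions (`i X_j` at the identity is
dissipative when `𝕜 = ℂ`), but it is real on those dominated by a multiple of `H`
(`IsDissipative.im_eq_zero`), which is all that is used.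
-/

namespace LieDissipative

open Filter Topology MeasureTheory

/-! ### Left-invariant fields in the chart at the identity -/

section Chart

variable {E : Type*} [NormedAddCommGroup E] [NormedSpace ℝ E]
  {G : Type*} [TopologicalSpace G] [ChartedSpace E G]
  {𝕜 : Type*} [RCLike 𝕜] {d : ℕ}

lemma contDiffAt_comp_chart_symm [IsManifold 𝓘(ℝ, E) ∞ G] {n : WithTop ℕ∞} (hn : n ≤ ∞) {f : G → 𝕜}
    (hf : ContMDiff 𝓘(ℝ, E) 𝓘(ℝ, 𝕜) n f) (x : G) {y : E}
    (hy : y ∈ (extChartAt 𝓘(ℝ, E) x).target) :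
    ContDiffAt ℝ n (f ∘ (extChartAt 𝓘(ℝ, E) x).symm) y := by
  have : IsManifold 𝓘(ℝ, E) n G := IsManifold.of_le hn
  have h1 := hf.comp_contMDiffOn (contMDiffOn_extChartAt_symm (I := 𝓘(ℝ, E)) (n := n) x)
  exact (contMDiffOn_iff_contDiffOn.1 h1).contDiffAt
    ((isOpen_extChartAt_target (I := 𝓘(ℝ, E)) x).mem_nhds hy)

variable [Group G]

/-- The left-invariant vector field with value `v` at the identity, read in the preferred chart
of `G` at the identity. It is only meaningful on the target of that chart. -/
noncomputable def chartField (v : GroupLieAlgebra 𝓘(ℝ, E) G) (y : E) : E :=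
  mfderiv 𝓘(ℝ, E) 𝓘(ℝ, E) (extChartAt 𝓘(ℝ, E) (1 : G)) ((extChartAt 𝓘(ℝ, E) (1 : G)).symm y)
    (mulInvariantVectorField v ((extChartAt 𝓘(ℝ, E) (1 : G)).symm y))

variable [LieGroup 𝓘(ℝ, E) ∞ G]

/-- In the chart at the identity, `lieDeriv` is differentiation along `chartField`. -/
lemma lieDeriv_chart_symm (v : GroupLieAlgebra 𝓘(ℝ, E) G) {f : G → 𝕜}
    (hf : ContMDiff 𝓘(ℝ, E) 𝓘(ℝ, 𝕜) 1 f) {y : E}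
    (hy : y ∈ (extChartAt 𝓘(ℝ, E) (1 : G)).target) :
    lieDeriv v f ((extChartAt 𝓘(ℝ, E) (1 : G)).symm y)
      = fderiv ℝ (f ∘ (extChartAt 𝓘(ℝ, E) (1 : G)).symm) y (chartField v y) := by
  have : IsManifold 𝓘(ℝ, E) 1 G := IsManifold.of_le (n := ∞) (by exact_mod_cast le_top)
  set ψ := extChartAt 𝓘(ℝ, E) (1 : G) with hψ
  have hx : ψ.symm y ∈ (chartAt E (1 : G)).source := by
    have := ψ.map_target hy
    rwa [hψ, extChartAt_source] at this
  have hF : HasMFDerivAt 𝓘(ℝ, E) 𝓘(ℝ, 𝕜) (f ∘ ψ.symm) (ψ (ψ.symm y))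
      (fderiv ℝ (f ∘ ψ.symm) y) := by
    rw [ψ.right_inv hy]
    exact ((contDiffAt_comp_chart_symm (n := 1) (by exact_mod_cast le_top) hf 1 hy).differentiableAt
      one_ne_zero).hasFDerivAt.hasMFDerivAt
  have hψd : HasMFDerivAt 𝓘(ℝ, E) 𝓘(ℝ, E) ψ (ψ.symm y) _ :=
    (mdifferentiableAt_extChartAt (I := 𝓘(ℝ, E)) hx).hasMFDerivAt
  have hev : f =ᶠ[𝓝 (ψ.symm y)] (f ∘ ψ.symm) ∘ ψ := by
    have hs : ψ.source ∈ 𝓝 (ψ.symm y) :=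
      (isOpen_extChartAt_source (I := 𝓘(ℝ, E)) (1 : G)).mem_nhds (ψ.map_target hy)
    filter_upwards [hs] with x hx
    simp [ψ.left_inv hx]
  have h := ((hF.comp _ hψd).congr_of_eventuallyEq hev).mfderiv
  exact DFunLike.congr_fun h (mulInvariantVectorField v (ψ.symm y))

lemma contDiffAt_chartField (v : GroupLieAlgebra 𝓘(ℝ, E) G) :
    ContDiffAt ℝ 1 (chartField v) (extChartAt 𝓘(ℝ, E) (1 : G) 1) := by
  have h3 : minSmoothness ℝ 3 ≤ (∞ : WithTop ℕ∞) := by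
    rw [minSmoothness_of_isRCLikeNormedField]
    exact WithTop.coe_le_coe.2 le_top
  have : LieGroup 𝓘(ℝ, E) (minSmoothness ℝ 3) G := LieGroup.of_le h3
  have : IsManifold 𝓘(ℝ, E) 2 G := IsManifold.of_le (n := ∞) (WithTop.coe_le_coe.2 le_top)
  have : IsManifold 𝓘(ℝ, E) 1 G := IsManifold.of_le (n := ∞) (by exact_mod_cast le_top)
  have h1 : ContMDiffAt 𝓘(ℝ, E) (𝓘(ℝ, E).prod 𝓘(ℝ, E)) 1
      (fun g : G => (mulInvariantVectorField v g : TangentBundle 𝓘(ℝ, E) G)) 1 :=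
    (contMDiffAt_mulInvariantVectorField v).of_le (by
      rw [minSmoothness_of_isRCLikeNormedField]; exact_mod_cast one_le_two)
  have h2 := (Bundle.contMDiffAt_section (1 : G)).1 h1
  set ψ := extChartAt 𝓘(ℝ, E) (1 : G) with hψ
  have hψ1 : ψ.symm (ψ 1) = 1 := ψ.left_inv (mem_extChartAt_source 1)
  have h4 : ContMDiffAt 𝓘(ℝ, E) 𝓘(ℝ, E) 1 ψ.symm (ψ 1) :=
    (contMDiffOn_extChartAt_symm (I := 𝓘(ℝ, E)) (n := 1) (1 : G)).contMDiffAt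
      (extChartAt_target_mem_nhds (I := 𝓘(ℝ, E)) (1 : G))
  rw [← hψ1] at h2
  have h5 := (h2.comp _ h4).contDiffAt
  refine h5.congr_of_eventuallyEq ?_
  filter_upwards [extChartAt_target_mem_nhds (I := 𝓘(ℝ, E)) (1 : G)] with y hy
  have hx : ψ.symm y ∈ (chartAt E (1 : G)).source := by
    have := ψ.map_target hy
    rwa [hψ, extChartAt_source] at this
  have h6 := TangentBundle.continuousLinearMapAt_trivializationAt (I := 𝓘(ℝ, E)) hx
  rw [hψ1]
  refine (DFunLike.congr_fun h6 (mulInvariantVectorField v (ψ.symm y))).symm.trans ?_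
  exact congrFun (Bundle.Trivialization.coe_linearMapAt_of_mem (R := ℝ)
    (trivializationAt E (TangentSpace 𝓘(ℝ, E)) (1 : G)) (by simpa using hx)) _

lemma chartField_one (v : GroupLieAlgebra 𝓘(ℝ, E) G) :
    chartField v (extChartAt 𝓘(ℝ, E) (1 : G) 1) = v := by
  have : IsManifold 𝓘(ℝ, E) 1 G := IsManifold.of_le (n := ∞) (by exact_mod_cast le_top)
  have h1 : (extChartAt 𝓘(ℝ, E) (1 : G)).symm (extChartAt 𝓘(ℝ, E) (1 : G) 1) = 1 :=
    (extChartAt 𝓘(ℝ, E) (1 : G)).left_inv (mem_extChartAt_source 1)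
  have h2 : mulInvariantVectorField v (1 : G) = v := by
    have : (fun x : G => 1 * x) = id := by ext; simp
    rw [mulInvariantVectorField, this, mfderiv_id]
    rfl
  rw [chartField, h1, h2, mfderiv_extChartAt_self]
  rfl

/-- Near a point where finitely many continuous vector fields form a basis, the norm of a linear
form is controlled, uniformly, by its values on these fields. -/
lemma eventually_opNorm_le_of_basis {F : Type*} [NormedAddCommGroup F] [NormedSpace ℝ F]
    [FiniteDimensional ℝ E] (e : Module.Basis (Fin d) ℝ E) {V : Fin d → E → E} {y₀ : E}
    (hV : ∀ j, ContinuousAt (V j) y₀) (hV0 : ∀ j, V j y₀ = e j) :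
    ∃ κ : ℝ, 0 ≤ κ ∧ ∀ᶠ y in 𝓝 y₀, ∀ (L : E →L[ℝ] F) (M : ℝ), 0 ≤ M →
      (∀ j, ‖L (V j y)‖ ≤ M) → ‖L‖ ≤ κ * M := by
  let T : E →L[ℝ] (Fin d → ℝ) := LinearMap.toContinuousLinearMap e.equivFun.toLinearMap
  have hT : ∀ w j, |e.repr w j| ≤ ‖T‖ * ‖w‖ := fun w j =>
    (norm_le_pi_norm (T w) j).trans (T.le_opNorm w)
  -- With this tolerance, replacing `V j y` by `e j` costs at most half of the norm of the form,
  -- which the left-hand side absorbs.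
  have hδ : (0 : ℝ) < 1 / (2 * (d * ‖T‖ + 1)) := by positivity
  refine ⟨2 * (d * ‖T‖), by positivity, ?_⟩
  have hev : ∀ᶠ y in 𝓝 y₀, ∀ j, ‖V j y - e j‖ < 1 / (2 * (d * ‖T‖ + 1)) := by
    refine eventually_all.2 fun j => ?_
    have := Metric.tendsto_nhds.1 (hV j) _ hδ
    simpa [dist_eq_norm, hV0 j] using this
  filter_upwards [hev] with y hy L M hM hL
  have hj : ∀ j, ‖L (e j)‖ ≤ M + ‖L‖ * (1 / (2 * (d * ‖T‖ + 1))) := fun j => by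
    have h : L (e j) = L (V j y) - L (V j y - e j) := by simp
    rw [h]
    refine (norm_sub_le _ _).trans (add_le_add (hL j) ((L.le_opNorm _).trans ?_))
    gcongr
    exact (hy j).le
  have hnorm : ‖L‖ ≤ d * ‖T‖ * (M + ‖L‖ * (1 / (2 * (d * ‖T‖ + 1)))) := by
    refine L.opNorm_le_bound (by positivity) fun w => ?_
    have hw : L w = ∑ j, e.repr w j • L (e j) := by
      conv_lhs => rw [← e.sum_repr w]
      simp only [map_sum, map_smul]
    rw [hw]
    calc ‖∑ j, e.repr w j • L (e j)‖ ≤ ∑ j : Fin d, ‖T‖ * ‖w‖ *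
          (M + ‖L‖ * (1 / (2 * (d * ‖T‖ + 1)))) := by
          refine norm_sum_le_of_le _ fun j _ => ?_
          rw [norm_smul]
          exact mul_le_mul (hT w j) (hj j) (norm_nonneg _) (by positivity)
      _ = _ := by simp; ring
  have hq : d * ‖T‖ * (1 / (2 * (d * ‖T‖ + 1))) ≤ 1 / 2 := by
    rw [mul_one_div, div_le_div_iff₀ (by positivity) (by norm_num)]
    linarith
  nlinarith [mul_le_mul_of_nonneg_right hq (norm_nonneg L)]

/-- At a critical point the second derivatives along left-invariant fields are the Hessian, hence
symmetric. -/
lemma lieDeriv_lieDeriv_one_symm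
    (b : Module.Basis (Fin d) ℝ (GroupLieAlgebra 𝓘(ℝ, E) G)) {f : G → 𝕜}
    (hf : ContMDiff 𝓘(ℝ, E) 𝓘(ℝ, 𝕜) 2 f) (hdf : ∀ j, lieDeriv (b j) f 1 = 0) (j k : Fin d) :
    lieDeriv (b j) (lieDeriv (b k) f) 1 = lieDeriv (b k) (lieDeriv (b j) f) 1 := by
  set ψ := extChartAt 𝓘(ℝ, E) (1 : G) with hψ
  have hψ1 : ψ.symm (ψ 1) = 1 := ψ.left_inv (mem_extChartAt_source 1)
  have ht : ψ 1 ∈ ψ.target := mem_extChartAt_target 1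
  have hF : ContDiffAt ℝ 2 (f ∘ ψ.symm) (ψ 1) :=
    contDiffAt_comp_chart_symm (WithTop.coe_le_coe.2 le_top) hf 1 ht
  have hf1 : ContMDiff 𝓘(ℝ, E) 𝓘(ℝ, 𝕜) 1 f := hf.of_le one_le_two
  have hD0 : fderiv ℝ (f ∘ ψ.symm) (ψ 1) = 0 := by
    have h0 : ∀ j, fderiv ℝ (f ∘ ψ.symm) (ψ 1) (b j) = 0 := fun j => by
      have := lieDeriv_chart_symm (b j) hf1 ht
      rw [chartField_one] at this
      rw [← this, hψ1, hdf j]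
    let e : Module.Basis (Fin d) ℝ E := b
    exact ContinuousLinearMap.coe_injective (e.ext h0)
  have hD : DifferentiableAt ℝ (fderiv ℝ (f ∘ ψ.symm)) (ψ 1) :=
    (hF.fderiv_right (m := 1) (by norm_num)).differentiableAt one_ne_zero
  have hess : ∀ j k, lieDeriv (b j) (lieDeriv (b k) f) 1
      = fderiv ℝ (fderiv ℝ (f ∘ ψ.symm)) (ψ 1) (b j) (b k) := by
    intro j k
    have h1 := lieDeriv_chart_symm (b j) (f := lieDeriv (b k) f)
      (contMDiff_lieDeriv (n := 2) (b k) one_le_two (by norm_num) hf) ht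
    rw [chartField_one, hψ1] at h1
    have hev : (lieDeriv (b k) f ∘ ψ.symm)
        =ᶠ[𝓝 (ψ 1)] fun y => fderiv ℝ (f ∘ ψ.symm) y (chartField (b k) y) := by
      filter_upwards [extChartAt_target_mem_nhds (I := 𝓘(ℝ, E)) (1 : G)] with y hy
      exact lieDeriv_chart_symm (b k) hf1 hy
    rw [h1, hev.fderiv_eq, fderiv_clm_apply hD
      ((contDiffAt_chartField (b k)).differentiableAt one_ne_zero), hD0, chartField_one,
      ContinuousLinearMap.zero_comp, zero_add]
    rfl
  rw [hess, hess]
  exact hF.isSymmSndFDerivAt (by rw [minSmoothness_of_isRCLikeNormedField]) _ _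

variable [FiniteDimensional ℝ E]

/-- The mean value inequality in the chart at the identity, in terms of left-invariant
derivatives: a function vanishing at the identity grows at most linearly. -/
lemma exists_chart_mean_value (𝕜 : Type*) [RCLike 𝕜]
    (b : Module.Basis (Fin d) ℝ (GroupLieAlgebra 𝓘(ℝ, E) G)) :
    ∃ κ : ℝ, 0 ≤ κ ∧ ∃ r : ℝ, 0 < r ∧
      ∀ (g : G → 𝕜), ContMDiff 𝓘(ℝ, E) 𝓘(ℝ, 𝕜) 1 g → g 1 = 0 → ∀ M : ℝ, 0 ≤ M →
      ∀ y ∈ Metric.ball (extChartAt 𝓘(ℝ, E) (1 : G) 1) r,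
      (∀ z ∈ Metric.closedBall (extChartAt 𝓘(ℝ, E) (1 : G) 1)
          ‖y - extChartAt 𝓘(ℝ, E) (1 : G) 1‖, ∀ j,
        ‖lieDeriv (b j) g ((extChartAt 𝓘(ℝ, E) (1 : G)).symm z)‖ ≤ M) →
      ‖g ((extChartAt 𝓘(ℝ, E) (1 : G)).symm y)‖ ≤ κ * M * ‖y - extChartAt 𝓘(ℝ, E) (1 : G) 1‖ := by
  set ψ := extChartAt 𝓘(ℝ, E) (1 : G) with hψ
  obtain ⟨κ, hκ, hev⟩ := eventually_opNorm_le_of_basis (F := 𝕜) (E := E) (y₀ := ψ 1)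
    (V := fun j => chartField (b j)) b
    (fun j => (contDiffAt_chartField (b j)).continuousAt) (fun j => chartField_one (b j))
  obtain ⟨r, hr, hball⟩ := Metric.eventually_nhds_iff_ball.1
    (hev.and (extChartAt_target_mem_nhds (I := 𝓘(ℝ, E)) (1 : G)))
  refine ⟨κ, hκ, r, hr, fun g hg hg1 M hM y hy hz => ?_⟩
  have hy' : ‖y - ψ 1‖ < r := by simpa [dist_eq_norm] using hy
  have hsub : ∀ z ∈ Metric.closedBall (ψ 1) ‖y - ψ 1‖, z ∈ Metric.ball (ψ 1) r := fun z hz =>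
    Metric.closedBall_subset_ball hy' hz
  have key := (convex_closedBall (ψ 1) ‖y - ψ 1‖).norm_image_sub_le_of_norm_fderiv_le (𝕜 := ℝ)
    (f := g ∘ ψ.symm) (C := κ * M) (x := ψ 1) (y := y)
    (fun z hz => (contDiffAt_comp_chart_symm (n := 1) (by exact_mod_cast le_top) hg 1
      (hball z (hsub z hz)).2).differentiableAt one_ne_zero)
    (fun z hz' => (hball z (hsub z hz')).1 _ M hM fun j => by
      rw [← lieDeriv_chart_symm (b j) hg (hball z (hsub z hz')).2]
      exact hz z hz' j)
    (Metric.mem_closedBall_self (norm_nonneg _)) (by simp [dist_eq_norm])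
  have h1 : ψ.symm (ψ 1) = 1 := ψ.left_inv (mem_extChartAt_source 1)
  simpa [h1, hg1] using key

/-- The second-order Taylor estimate at the identity, from two applications of the mean value
inequality: only the second derivatives along the frame enter. -/
lemma exists_chart_taylor (𝕜 : Type*) [RCLike 𝕜]
    (b : Module.Basis (Fin d) ℝ (GroupLieAlgebra 𝓘(ℝ, E) G)) :
    ∃ κ : ℝ, 0 ≤ κ ∧ ∃ r : ℝ, 0 < r ∧
      ∀ (f : G → 𝕜), ContMDiff 𝓘(ℝ, E) 𝓘(ℝ, 𝕜) 2 f → f 1 = 0 → (∀ j, lieDeriv (b j) f 1 = 0) →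
      ∀ M : ℝ, 0 ≤ M → ∀ y ∈ Metric.ball (extChartAt 𝓘(ℝ, E) (1 : G) 1) r,
      (∀ z ∈ Metric.closedBall (extChartAt 𝓘(ℝ, E) (1 : G) 1)
          ‖y - extChartAt 𝓘(ℝ, E) (1 : G) 1‖, ∀ j k,
        ‖lieDeriv (b j) (lieDeriv (b k) f) ((extChartAt 𝓘(ℝ, E) (1 : G)).symm z)‖ ≤ M) →
      ‖f ((extChartAt 𝓘(ℝ, E) (1 : G)).symm y)‖
        ≤ κ * M * ‖y - extChartAt 𝓘(ℝ, E) (1 : G) 1‖ ^ 2 := by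
  obtain ⟨κ, hκ, r, hr, h⟩ := exists_chart_mean_value 𝕜 b
  set ψ := extChartAt 𝓘(ℝ, E) (1 : G) with hψ
  refine ⟨κ * κ, by positivity, r, hr, fun f hf hf1 hdf M hM y hy hz => ?_⟩
  have hfirst : ∀ z ∈ Metric.closedBall (ψ 1) ‖y - ψ 1‖, ∀ j,
      ‖lieDeriv (b j) f (ψ.symm z)‖ ≤ κ * M * ‖y - ψ 1‖ := by
    intro z hzy j
    have hzn : ‖z - ψ 1‖ ≤ ‖y - ψ 1‖ := by simpa [dist_eq_norm] using hzy
    have hzr : z ∈ Metric.ball (ψ 1) r := by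
      rw [mem_ball_iff_norm] at hy ⊢
      exact hzn.trans_lt hy
    refine (h (lieDeriv (b j) f) (contMDiff_lieDeriv (n := 2) (b j) one_le_two
      (by norm_num) hf) (hdf j) M hM z hzr fun w hw i => hz w
        (Metric.closedBall_subset_closedBall hzn hw) i j).trans ?_
    gcongr
  refine (h f (hf.of_le one_le_two) hf1 _ (by positivity) y hy hfirst).trans (le_of_eq ?_)
  ring

/-- Functions forming coordinates at the identity control the squared distance in the chart. -/
lemma exists_sq_norm_chart_le (b : Module.Basis (Fin d) ℝ (GroupLieAlgebra 𝓘(ℝ, E) G))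
    {φ : Fin d → TestFun E G ℝ} (hφ : IsCoordinateSystem b φ) :
    ∃ c : ℝ, 0 ≤ c ∧ ∀ᶠ y in 𝓝 (extChartAt 𝓘(ℝ, E) (1 : G) 1),
      ‖y - extChartAt 𝓘(ℝ, E) (1 : G) 1‖ ^ 2
        ≤ c * ∑ k, φ k ((extChartAt 𝓘(ℝ, E) (1 : G)).symm y) ^ 2 := by
  set ψ := extChartAt 𝓘(ℝ, E) (1 : G) with hψ
  have hψ1 : ψ.symm (ψ 1) = 1 := ψ.left_inv (mem_extChartAt_source 1)
  have ht : ψ 1 ∈ ψ.target := mem_extChartAt_target 1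
  have hφ1 : ∀ k, ContMDiff 𝓘(ℝ, E) 𝓘(ℝ, ℝ) 1 (φ k).1 := fun k =>
    (φ k).2.1.of_le (by exact_mod_cast le_top)
  let bE : Module.Basis (Fin d) ℝ E := b
  let e : E ≃L[ℝ] (Fin d → ℝ) := bE.equivFun.toContinuousLinearEquiv
  have hderiv : HasFDerivAt (fun y k => φ k (ψ.symm y)) (e : E →L[ℝ] (Fin d → ℝ)) (ψ 1) := by
    rw [hasFDerivAt_pi']
    intro k
    have h1 := (contDiffAt_comp_chart_symm (n := 1) (by exact_mod_cast le_top) (hφ1 k) 1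
      ht).differentiableAt one_ne_zero
    suffices h : ∀ j, (e (bE j)) k = fderiv ℝ ((φ k).1 ∘ ψ.symm) (ψ 1) (bE j) by
      have hlin : ((ContinuousLinearMap.proj k).comp (e : E →L[ℝ] (Fin d → ℝ))).toLinearMap
          = (fderiv ℝ ((φ k).1 ∘ ψ.symm) (ψ 1)).toLinearMap := bE.ext h
      rw [ContinuousLinearMap.coe_injective hlin]
      exact h1.hasFDerivAt
    intro j
    have h2 := lieDeriv_chart_symm (b j) (hφ1 k) ht
    rw [chartField_one, hψ1, hφ.lieDeriv_one] at h2
    refine Eq.trans ?_ h2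
    exact bE.equivFun_self j k
  have hO : (fun y => y - ψ 1) =O[𝓝 (ψ 1)]
      fun y => (fun k => φ k (ψ.symm y)) - fun k => φ k (ψ.symm (ψ 1)) := by
    have h1 := e.isBigO_sub_rev (𝓝 (ψ 1)) (ψ 1)
    refine h1.trans ((hderiv.isLittleO.trans_isBigO h1).right_isBigO_add.congr_right fun y => ?_)
    exact sub_add_cancel _ _
  obtain ⟨c, hc, hcO⟩ := hO.exists_nonneg
  refine ⟨c ^ 2, by positivity, ?_⟩
  filter_upwards [hcO.bound] with y hy
  have hφ0 : (fun k => φ k (ψ.symm (ψ 1))) = 0 := by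
    funext k
    rw [hψ1]
    exact hφ.apply_one k
  have hy' : ‖y - ψ 1‖ ≤ c * ‖fun k => φ k (ψ.symm y)‖ := by
    rw [hφ0] at hy
    simpa using hy
  have hsup : ‖fun k => φ k (ψ.symm y)‖ ^ 2 ≤ ∑ k, φ k (ψ.symm y) ^ 2 := by
    refine (Real.le_sqrt (norm_nonneg _) (Finset.sum_nonneg fun _ _ => sq_nonneg _)).1 ?_
    refine (pi_norm_le_iff_of_nonneg (Real.sqrt_nonneg _)).2 fun k => ?_
    rw [Real.norm_eq_abs]
    refine Real.abs_le_sqrt ?_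
    exact Finset.single_le_sum (f := fun k => φ k (ψ.symm y) ^ 2)
      (fun _ _ => sq_nonneg _) (Finset.mem_univ k)
  calc ‖y - ψ 1‖ ^ 2 ≤ (c * ‖fun k => φ k (ψ.symm y)‖) ^ 2 := by gcongr
    _ = c ^ 2 * ‖fun k => φ k (ψ.symm y)‖ ^ 2 := by ring
    _ ≤ _ := by gcongr

end Chart

/-! ### Comparison with the Hunt function -/

section Hunt

namespace TestFun

variable {E : Type*} [NormedAddCommGroup E] [NormedSpace ℝ E]
  {G : Type*} [TopologicalSpace G] [ChartedSpace E G] {𝕜 : Type*} [RCLike 𝕜]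

lemma continuous (f : TestFun E G 𝕜) : Continuous f :=
  f.2.1.continuous

lemma contMDiff_one (f : TestFun E G 𝕜) : ContMDiff 𝓘(ℝ, E) 𝓘(ℝ, 𝕜) 1 f :=
  f.2.1.of_le (WithTop.coe_le_coe.2 le_top)

end TestFun

variable {E : Type*} [NormedAddCommGroup E] [NormedSpace ℝ E]
  {G : Type*} [TopologicalSpace G] [ChartedSpace E G] [Group G]
  {d : ℕ} {φ : Fin d → TestFun E G ℝ} {Φ : TestFun E G ℝ}

lemma IsHuntCutoff.one_sub_nonneg (hΦ : IsHuntCutoff φ Φ) (x : G) : 0 ≤ 1 - Φ x :=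
  sub_nonneg.2 (hΦ.le_one x)

lemma IsHuntCutoff.one_sub_pos (hΦ : IsHuntCutoff φ Φ) {x : G} (hx : x ≠ 1) : 0 < 1 - Φ x :=
  sub_pos.2 (hΦ.lt_one x hx)

lemma IsHuntCutoff.exists_pos_le (hΦ : IsHuntCutoff φ Φ) {U : Set G} (hU : U ∈ 𝓝 (1 : G)) :
    ∃ ε : ℝ, 0 < ε ∧ ∀ x ∉ U, ε ≤ 1 - Φ x := by
  have hK : IsCompact (tsupport Φ \ interior U) := IsCompact.diff Φ.2.2 isOpen_interior
  have hout : ∀ x ∉ U, x ∉ tsupport Φ \ interior U → Φ x = 0 := fun x hx hx' => by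
    by_contra h
    exact hx' ⟨subset_tsupport _ h, fun h' => hx (interior_subset h')⟩
  rcases (tsupport Φ \ interior U).eq_empty_or_nonempty with h | h
  · refine ⟨1, one_pos, fun x hx => ?_⟩
    rw [hout x hx (by simp [h])]
    simp
  · obtain ⟨z, hz, hmax⟩ := hK.exists_isMaxOn h Φ.continuous.continuousOn
    have hz1 : z ≠ 1 := fun h1 => hz.2 (h1 ▸ mem_interior_iff_mem_nhds.2 hU)
    refine ⟨1 - Φ z, hΦ.one_sub_pos hz1, fun x hx => ?_⟩
    by_cases hx' : x ∈ tsupport Φ \ interior U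
    · linarith [isMaxOn_iff.1 hmax x hx']
    · rw [hout x hx hx']
      linarith [hΦ.nonneg z]

lemma IsHuntCutoff.apply_one {b : Module.Basis (Fin d) ℝ (GroupLieAlgebra 𝓘(ℝ, E) G)}
    (hφ : IsCoordinateSystem b φ) (hΦ : IsHuntCutoff φ Φ) : Φ 1 = 1 := by
  rw [hΦ.eq_near_one.self_of_nhds]
  simp [hφ.apply_one]

variable [LieGroup 𝓘(ℝ, E) ∞ G] [FiniteDimensional ℝ E]

/-- The Taylor estimate on a neighbourhood of the identity that does not depend on the function,
with the squared distance replaced by the Hunt function. -/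
lemma exists_local_norm_le_hunt (𝕜 : Type*) [RCLike 𝕜]
    {b : Module.Basis (Fin d) ℝ (GroupLieAlgebra 𝓘(ℝ, E) G)}
    (hφ : IsCoordinateSystem b φ) (hΦ : IsHuntCutoff φ Φ) :
    ∃ κ : ℝ, 0 ≤ κ ∧ ∃ r : ℝ, 0 < r ∧ ∃ N ∈ 𝓝 (1 : G),
      ∀ (f : G → 𝕜), ContMDiff 𝓘(ℝ, E) 𝓘(ℝ, 𝕜) 2 f → f 1 = 0 → (∀ j, lieDeriv (b j) f 1 = 0) →
      ∀ M : ℝ, 0 ≤ M → ∀ ρ ≤ r,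
      (∀ z ∈ Metric.ball (extChartAt 𝓘(ℝ, E) (1 : G) 1) ρ, ∀ j k,
        ‖lieDeriv (b j) (lieDeriv (b k) f) ((extChartAt 𝓘(ℝ, E) (1 : G)).symm z)‖ ≤ M) →
      ∀ x ∈ N, extChartAt 𝓘(ℝ, E) (1 : G) x ∈ Metric.ball (extChartAt 𝓘(ℝ, E) (1 : G) 1) ρ →
        ‖f x‖ ≤ κ * M * (1 - Φ x) := by
  obtain ⟨κ, hκ, r, hr, h⟩ := exists_chart_taylor 𝕜 b
  obtain ⟨c, hc, hev⟩ := exists_sq_norm_chart_le b hφ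
  set ψ := extChartAt 𝓘(ℝ, E) (1 : G) with hψ
  have hcont : ContinuousAt ψ 1 := continuousAt_extChartAt (I := 𝓘(ℝ, E)) (1 : G)
  refine ⟨κ * c, by positivity, r, hr, _, ((hcont.eventually hev).and
    (hΦ.eq_near_one.and (extChartAt_source_mem_nhds (I := 𝓘(ℝ, E)) (1 : G)))),
    fun f hf hf1 hdf M hM ρ hρ hz x hx hxρ => ?_⟩
  obtain ⟨hx1, hx2, hx3⟩ := hx
  have hxs : ψ.symm (ψ x) = x := ψ.left_inv hx3
  rw [hxs] at hx1
  have hxn : ‖ψ x - ψ 1‖ < ρ := by simpa [dist_eq_norm] using hxρ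
  have h1 := h f hf hf1 hdf M hM (ψ x) (Metric.ball_subset_ball hρ hxρ)
    (fun z hzx => hz z (Metric.closedBall_subset_ball hxn hzx))
  rw [hxs] at h1
  rw [hx2, sub_sub_cancel]
  calc ‖f x‖ ≤ κ * M * ‖ψ x - ψ 1‖ ^ 2 := h1
    _ ≤ κ * M * (c * ∑ k, φ k x ^ 2) := by gcongr
    _ = κ * c * M * ∑ k, φ k x ^ 2 := by ring

/-- A function vanishing to first order at the identity is dominated by the Hunt function
`1 - Φ`, uniformly on the unit ball of `C_b²(G)`. -/
lemma exists_norm_le_hunt (𝕜 : Type*) [RCLike 𝕜]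
    {b : Module.Basis (Fin d) ℝ (GroupLieAlgebra 𝓘(ℝ, E) G)}
    (hφ : IsCoordinateSystem b φ) (hΦ : IsHuntCutoff φ Φ) :
    ∃ K : ℝ, 0 ≤ K ∧ ∀ f : CbTwo 𝕜 b, f 1 = 0 → (∀ j, lieDeriv (b j) f 1 = 0) →
      ∀ x, ‖f x‖ ≤ K * ‖f‖ * (1 - Φ x) := by
  obtain ⟨κ, hκ, r, hr, N, hN, h⟩ := exists_local_norm_le_hunt 𝕜 hφ hΦ
  have hcont : ContinuousAt (extChartAt 𝓘(ℝ, E) (1 : G)) 1 :=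
    continuousAt_extChartAt (I := 𝓘(ℝ, E)) (1 : G)
  obtain ⟨ε, hε, hout⟩ := hΦ.exists_pos_le
    (Filter.inter_mem hN (hcont (Metric.ball_mem_nhds _ hr)))
  refine ⟨max κ ε⁻¹, le_max_of_le_left hκ, fun f hf1 hdf x => ?_⟩
  have h0 := hΦ.one_sub_nonneg x
  by_cases hx : x ∈ N ∩ extChartAt 𝓘(ℝ, E) (1 : G) ⁻¹'
      Metric.ball (extChartAt 𝓘(ℝ, E) (1 : G) 1) r
  · refine (h f f.2.1 hf1 hdf ‖f‖ (norm_nonneg _) r le_rfl (fun z _ j k =>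
      f.norm_iterLieDeriv_le [j, k] le_rfl _) x hx.1 hx.2).trans ?_
    gcongr
    exact le_max_left _ _
  · calc ‖f x‖ ≤ ‖f‖ := f.norm_iterLieDeriv_le [] (by simp) x
      _ = ε⁻¹ * ‖f‖ * ε := by field_simp
      _ ≤ max κ ε⁻¹ * ‖f‖ * (1 - Φ x) := by
        gcongr
        · exact le_max_right _ _
        · exact hout x hx

/-- A function vanishing to second order at the identity is negligible there with respect to the
Hunt function `1 - Φ`. -/
lemma eventually_norm_le_hunt {𝕜 : Type*} [RCLike 𝕜]
    {b : Module.Basis (Fin d) ℝ (GroupLieAlgebra 𝓘(ℝ, E) G)}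
    (hφ : IsCoordinateSystem b φ) (hΦ : IsHuntCutoff φ Φ) {f : G → 𝕜}
    (hf : ContMDiff 𝓘(ℝ, E) 𝓘(ℝ, 𝕜) 2 f) (hf1 : f 1 = 0) (hdf : ∀ j, lieDeriv (b j) f 1 = 0)
    (hddf : ∀ j k, lieDeriv (b j) (lieDeriv (b k) f) 1 = 0) {ε : ℝ} (hε : 0 < ε) :
    ∀ᶠ x in 𝓝 (1 : G), ‖f x‖ ≤ ε * (1 - Φ x) := by
  obtain ⟨κ, hκ, r, hr, N, hN, h⟩ := exists_local_norm_le_hunt 𝕜 hφ hΦ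
  set ψ := extChartAt 𝓘(ℝ, E) (1 : G) with hψ
  have hψ1 : ψ.symm (ψ 1) = 1 := ψ.left_inv (mem_extChartAt_source 1)
  have hcont : ContinuousAt ψ 1 := continuousAt_extChartAt (I := 𝓘(ℝ, E)) (1 : G)
  have hsymm : ContinuousAt ψ.symm (ψ 1) := continuousAt_extChartAt_symm (I := 𝓘(ℝ, E)) (1 : G)
  have hδ : 0 < ε / (κ + 1) := by positivity
  have hsmall : ∀ᶠ z in 𝓝 (ψ 1), ∀ j k,
      ‖lieDeriv (b j) (lieDeriv (b k) f) (ψ.symm z)‖ < ε / (κ + 1) := by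
    refine eventually_all.2 fun j => eventually_all.2 fun k => ?_
    have hc : Continuous (lieDeriv (b j) (lieDeriv (b k) f)) :=
      (contMDiff_iterLieDeriv b hf [j, k] 0 le_rfl).continuous
    have h0 : Tendsto ψ.symm (𝓝 (ψ 1)) (𝓝 1) := by
      have := hsymm.tendsto
      rwa [hψ1] at this
    have h1 := (hc.norm.tendsto 1).comp h0
    rw [hddf j k, norm_zero] at h1
    exact h1.eventually_lt_const hδ
  obtain ⟨ρ, hρ, hball⟩ := Metric.eventually_nhds_iff_ball.1 hsmall
  filter_upwards [hN, hcont (Metric.ball_mem_nhds _ (lt_min hρ hr))] with x hxN hx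
  refine (h f hf hf1 hdf _ hδ.le (min ρ r) (min_le_right _ _) (fun z hz j k =>
    (hball z (Metric.ball_subset_ball (min_le_left _ _) hz) j k).le) x hxN hx).trans ?_
  have h0 := hΦ.one_sub_nonneg x
  gcongr
  rw [mul_div_assoc', div_le_iff₀ (by positivity)]
  nlinarith

end Hunt

/-! ### Second-order Taylor expansion at the identity -/

section Taylor

variable {E : Type*} [NormedAddCommGroup E] [NormedSpace ℝ E]
  {G : Type*} [TopologicalSpace G] [ChartedSpace E G] [Group G]
  {𝕜 : Type*} [RCLike 𝕜] {d : ℕ}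

lemma lieDeriv_mul (v : GroupLieAlgebra 𝓘(ℝ, E) G) {f g : G → ℝ}
    (hf : ContMDiff 𝓘(ℝ, E) 𝓘(ℝ, ℝ) 1 f) (hg : ContMDiff 𝓘(ℝ, E) 𝓘(ℝ, ℝ) 1 g) :
    lieDeriv v (f * g) = f * lieDeriv v g + g * lieDeriv v f := by
  funext x
  have h := ((hf.mdifferentiable one_ne_zero x).hasMFDerivAt.mul
    (hg.mdifferentiable one_ne_zero x).hasMFDerivAt).mfderiv
  exact DFunLike.congr_fun h (mulInvariantVectorField v x)

lemma lieDeriv_ofReal (v : GroupLieAlgebra 𝓘(ℝ, E) G) {f : G → ℝ}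
    (hf : ContMDiff 𝓘(ℝ, E) 𝓘(ℝ, ℝ) 1 f) :
    lieDeriv v (fun x => (f x : 𝕜)) = fun x => ((lieDeriv v f x : ℝ) : 𝕜) := by
  funext x
  have hL : HasMFDerivAt 𝓘(ℝ, ℝ) 𝓘(ℝ, 𝕜) (fun y : ℝ => (y : 𝕜)) (f x)
      (RCLike.ofRealCLM (K := 𝕜)) := (RCLike.ofRealCLM (K := 𝕜)).hasFDerivAt.hasMFDerivAt
  have h := (hL.comp x (hf.mdifferentiable one_ne_zero x).hasMFDerivAt).mfderiv
  exact DFunLike.congr_fun h (mulInvariantVectorField v x)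

variable {b : Module.Basis (Fin d) ℝ (GroupLieAlgebra 𝓘(ℝ, E) G)}
  {φ : Fin d → TestFun E G ℝ} {Φ : TestFun E G ℝ}

lemma IsCoordinateSystem.lieDeriv_mul_one (hφ : IsCoordinateSystem b φ) (i j k : Fin d) :
    lieDeriv (b i) (φ j * φ k : TestFun E G ℝ) 1 = 0 := by
  have h := congrFun (lieDeriv_mul (b i) (φ j).contMDiff_one (φ k).contMDiff_one) 1
  simp only [Pi.add_apply, Pi.mul_apply, hφ.apply_one, zero_mul, add_zero] at h
  exact h

variable [LieGroup 𝓘(ℝ, E) ∞ G]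

lemma TestFun.contMDiff_lieDeriv (f : TestFun E G 𝕜) (v : GroupLieAlgebra 𝓘(ℝ, E) G) :
    ContMDiff 𝓘(ℝ, E) 𝓘(ℝ, 𝕜) 1 (lieDeriv v f) :=
  LieDissipative.contMDiff_lieDeriv (n := 2) v one_le_two (by norm_num)
    (f.2.1.of_le (WithTop.coe_le_coe.2 le_top))

lemma IsHuntCutoff.lieDeriv_one (hφ : IsCoordinateSystem b φ) (hΦ : IsHuntCutoff φ Φ)
    (v : GroupLieAlgebra 𝓘(ℝ, E) G) : lieDeriv v Φ 1 = 0 := by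
  set ψ := extChartAt 𝓘(ℝ, E) (1 : G) with hψ
  have hψ1 : ψ.symm (ψ 1) = 1 := ψ.left_inv (mem_extChartAt_source 1)
  have h1 := lieDeriv_chart_symm v Φ.contMDiff_one (mem_extChartAt_target 1)
  have hmax : IsLocalMax (Φ ∘ ψ.symm) (ψ 1) := Eventually.of_forall fun y => by
    simp only [Function.comp, hψ1, hΦ.apply_one hφ]
    exact hΦ.le_one _
  rw [← hψ, hψ1, hmax.fderiv_eq_zero] at h1
  exact h1

variable (b) in
/-- The inclusion of `C_c^∞(G)` in `C_b²(G)` as a linear map. -/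
noncomputable def TestFun.toCbTwoₗ : TestFun E G 𝕜 →ₗ[𝕜] CbTwo 𝕜 b where
  toFun f := f.toCbTwo b
  map_add' _ _ := rfl
  map_smul' _ _ := rfl

variable (𝕜 b) in
/-- The linear functional `f ↦ X^w f(e)` on `C_b²(G)`, for a word `w` of length at most two. -/
noncomputable def jet (w : List (Fin d)) (hw : w.length ≤ 2) : CbTwo 𝕜 b →ₗ[𝕜] 𝕜 where
  toFun f := iterLieDeriv b w f 1
  map_add' f g := congrFun (iterLieDeriv_add b f.2.1 g.2.1 w hw) 1
  map_smul' c f := congrFun (iterLieDeriv_smul b c f.2.1 w hw) 1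

variable (𝕜 b) in
/-- The linear functional `f ↦ f(e)` on `C_b²(G)`. -/
noncomputable def jetZero : CbTwo 𝕜 b →ₗ[𝕜] 𝕜 := jet 𝕜 b [] (by simp)

variable (𝕜 b) in
/-- The linear functional `f ↦ X_j f(e)` on `C_b²(G)`. -/
noncomputable def jetOne (j : Fin d) : CbTwo 𝕜 b →ₗ[𝕜] 𝕜 := jet 𝕜 b [j] (by simp)

variable (𝕜 b) in
/-- The linear functional `f ↦ X_j X_k f(e)` on `C_b²(G)`. -/
noncomputable def jetTwo (j k : Fin d) : CbTwo 𝕜 b →ₗ[𝕜] 𝕜 := jet 𝕜 b [j, k] (by simp)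

lemma jetZero_apply (f : CbTwo 𝕜 b) : jetZero 𝕜 b f = f 1 := rfl

lemma jetOne_apply (j : Fin d) (f : CbTwo 𝕜 b) : jetOne 𝕜 b j f = lieDeriv (b j) f 1 := rfl

lemma jetTwo_apply (j k : Fin d) (f : CbTwo 𝕜 b) :
    jetTwo 𝕜 b j k f = lieDeriv (b j) (lieDeriv (b k) f) 1 := rfl

lemma norm_jetZero_le (f : CbTwo 𝕜 b) : ‖jetZero 𝕜 b f‖ ≤ ‖f‖ :=
  f.norm_iterLieDeriv_le [] (by simp) 1

lemma norm_jetOne_le (j : Fin d) (f : CbTwo 𝕜 b) : ‖jetOne 𝕜 b j f‖ ≤ ‖f‖ :=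
  f.norm_iterLieDeriv_le [j] (by simp) 1

lemma norm_jetTwo_le (j k : Fin d) (f : CbTwo 𝕜 b) : ‖jetTwo 𝕜 b j k f‖ ≤ ‖f‖ :=
  f.norm_iterLieDeriv_le [j, k] (by simp) 1

variable (𝕜 b φ Φ) in
/-- The part `f(e) Φ + ∑ X_j f(e) φ_j` of the Taylor expansion of `f` at the identity. -/
noncomputable def taylorOne : CbTwo 𝕜 b →ₗ[𝕜] TestFun E G 𝕜 :=
  (jetZero 𝕜 b).smulRight (Φ.ofReal 𝕜) + ∑ j, (jetOne 𝕜 b j).smulRight ((φ j).ofReal 𝕜)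

variable (𝕜 b φ Φ) in
/-- The coefficient of `φ_j φ_k` in the Taylor expansion at the identity. The derivative is taken
after the first-order part has been removed, so that it is symmetric in `j` and `k`. -/
noncomputable def taylorCoeff (j k : Fin d) : CbTwo 𝕜 b →ₗ[𝕜] 𝕜 :=
  (2⁻¹ : 𝕜) • jetTwo 𝕜 b j k ∘ₗ (LinearMap.id - TestFun.toCbTwoₗ b ∘ₗ taylorOne 𝕜 b φ Φ)

variable (𝕜 b φ Φ) in
/-- The second-order Taylor expansion at the identity, written with the test functions
`Φ`, `φ_j` and `φ_j φ_k` in place of the monomials. -/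
noncomputable def taylor : CbTwo 𝕜 b →ₗ[𝕜] TestFun E G 𝕜 :=
  taylorOne 𝕜 b φ Φ + ∑ j, ∑ k, (taylorCoeff 𝕜 b φ Φ j k).smulRight ((φ j * φ k).ofReal 𝕜)

variable (𝕜 b φ Φ) in
/-- The remainder of the second-order Taylor expansion at the identity. -/
noncomputable def taylorRem : CbTwo 𝕜 b →ₗ[𝕜] CbTwo 𝕜 b :=
  LinearMap.id - TestFun.toCbTwoₗ b ∘ₗ taylor 𝕜 b φ Φ

lemma taylorOne_apply (f : CbTwo 𝕜 b) :
    taylorOne 𝕜 b φ Φ f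
      = jetZero 𝕜 b f • Φ.ofReal 𝕜 + ∑ j, jetOne 𝕜 b j f • (φ j).ofReal 𝕜 := by
  simp [taylorOne]

lemma taylor_apply (f : CbTwo 𝕜 b) :
    taylor 𝕜 b φ Φ f = taylorOne 𝕜 b φ Φ f
      + ∑ j, ∑ k, taylorCoeff 𝕜 b φ Φ j k f • (φ j * φ k).ofReal 𝕜 := by
  simp [taylor]

lemma taylorRem_apply (f : CbTwo 𝕜 b) :
    taylorRem 𝕜 b φ Φ f = f - TestFun.toCbTwoₗ b (taylor 𝕜 b φ Φ f) := rfl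

lemma jetZero_ofReal (f : TestFun E G ℝ) :
    jetZero 𝕜 b (TestFun.toCbTwoₗ b (f.ofReal 𝕜)) = (f 1 : 𝕜) := rfl

lemma jetOne_ofReal (j : Fin d) (f : TestFun E G ℝ) :
    jetOne 𝕜 b j (TestFun.toCbTwoₗ b (f.ofReal 𝕜)) = ((lieDeriv (b j) f 1 : ℝ) : 𝕜) :=
  congrFun (lieDeriv_ofReal (b j) f.contMDiff_one) 1

lemma jetTwo_ofReal (j k : Fin d) (f : TestFun E G ℝ) :
    jetTwo 𝕜 b j k (TestFun.toCbTwoₗ b (f.ofReal 𝕜))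
      = ((lieDeriv (b j) (lieDeriv (b k) f) 1 : ℝ) : 𝕜) := by
  have h1 : lieDeriv (b k) (f.ofReal 𝕜) = fun x => ((lieDeriv (b k) f x : ℝ) : 𝕜) :=
    lieDeriv_ofReal (b k) f.contMDiff_one
  have h2 := congrFun (lieDeriv_ofReal (𝕜 := 𝕜) (b j) (f.contMDiff_lieDeriv (b k))) 1
  rw [← h1] at h2
  exact h2

lemma IsCoordinateSystem.lieDeriv_lieDeriv_mul_one (hφ : IsCoordinateSystem b φ)
    (l m j k : Fin d) :
    lieDeriv (b l) (lieDeriv (b m) (φ j * φ k : TestFun E G ℝ)) 1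
      = (if l = j then 1 else 0) * (if m = k then 1 else 0)
        + (if l = k then 1 else 0) * (if m = j then 1 else 0) := by
  have h1 : lieDeriv (b m) (φ j * φ k : TestFun E G ℝ)
      = (φ j : G → ℝ) * lieDeriv (b m) (φ k) + (φ k : G → ℝ) * lieDeriv (b m) (φ j) :=
    lieDeriv_mul (b m) (φ j).contMDiff_one (φ k).contMDiff_one
  have hjk := (φ k).contMDiff_lieDeriv (b m)
  have hkj := (φ j).contMDiff_lieDeriv (b m)
  rw [h1, lieDeriv_add (b l) ((φ j).contMDiff_one.mul hjk) ((φ k).contMDiff_one.mul hkj),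
    lieDeriv_mul (b l) (φ j).contMDiff_one hjk, lieDeriv_mul (b l) (φ k).contMDiff_one hkj]
  simp only [Pi.add_apply, Pi.mul_apply, hφ.apply_one, hφ.lieDeriv_one]
  ring

lemma jetZero_sub_taylorOne (hφ : IsCoordinateSystem b φ) (hΦ : IsHuntCutoff φ Φ)
    (f : CbTwo 𝕜 b) :
    jetZero 𝕜 b (f - TestFun.toCbTwoₗ b (taylorOne 𝕜 b φ Φ f)) = 0 := by
  simp [taylorOne_apply, jetZero_ofReal, hΦ.apply_one hφ, hφ.apply_one]

lemma jetOne_sub_taylorOne (hφ : IsCoordinateSystem b φ) (hΦ : IsHuntCutoff φ Φ)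
    (i : Fin d) (f : CbTwo 𝕜 b) :
    jetOne 𝕜 b i (f - TestFun.toCbTwoₗ b (taylorOne 𝕜 b φ Φ f)) = 0 := by
  simp [taylorOne_apply, jetOne_ofReal, hΦ.lieDeriv_one hφ, hφ.lieDeriv_one]

lemma taylorCoeff_symm (hφ : IsCoordinateSystem b φ) (hΦ : IsHuntCutoff φ Φ)
    (j k : Fin d) (f : CbTwo 𝕜 b) :
    taylorCoeff 𝕜 b φ Φ j k f = taylorCoeff 𝕜 b φ Φ k j f := by
  have h := lieDeriv_lieDeriv_one_symm b
    (f - TestFun.toCbTwoₗ b (taylorOne 𝕜 b φ Φ f) : CbTwo 𝕜 b).2.1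
    (fun i => jetOne_sub_taylorOne hφ hΦ i f) j k
  exact congrArg ((2⁻¹ : 𝕜) • ·) h

lemma taylorRem_apply_one (hφ : IsCoordinateSystem b φ) (hΦ : IsHuntCutoff φ Φ)
    (f : CbTwo 𝕜 b) : taylorRem 𝕜 b φ Φ f 1 = 0 := by
  rw [← jetZero_apply, taylorRem_apply, taylor_apply, map_add, ← sub_sub, map_sub,
    jetZero_sub_taylorOne hφ hΦ]
  have h : ∀ j k, (φ j * φ k : TestFun E G ℝ) 1 = 0 := fun j k => by
    change φ j 1 * φ k 1 = 0
    rw [hφ.apply_one, zero_mul]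
  simp [jetZero_ofReal, h]

lemma lieDeriv_taylorRem_one (hφ : IsCoordinateSystem b φ) (hΦ : IsHuntCutoff φ Φ)
    (f : CbTwo 𝕜 b) (i : Fin d) : lieDeriv (b i) (taylorRem 𝕜 b φ Φ f) 1 = 0 := by
  rw [← jetOne_apply, taylorRem_apply, taylor_apply, map_add, ← sub_sub, map_sub,
    jetOne_sub_taylorOne hφ hΦ]
  simp [jetOne_ofReal, hφ.lieDeriv_mul_one]

lemma lieDeriv_lieDeriv_taylorRem_one (hφ : IsCoordinateSystem b φ) (hΦ : IsHuntCutoff φ Φ)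
    (f : CbTwo 𝕜 b) (l m : Fin d) :
    lieDeriv (b l) (lieDeriv (b m) (taylorRem 𝕜 b φ Φ f)) 1 = 0 := by
  rw [← jetTwo_apply, taylorRem_apply, taylor_apply, map_add, ← sub_sub, map_sub]
  -- `X_l X_m (φ_j φ_k)` at the identity is `δ_lj δ_mk + δ_lk δ_mj`, so both coefficients appear.
  have h1 : jetTwo 𝕜 b l m (f - TestFun.toCbTwoₗ b (taylorOne 𝕜 b φ Φ f))
      = taylorCoeff 𝕜 b φ Φ l m f + taylorCoeff 𝕜 b φ Φ m l f := by
    rw [taylorCoeff_symm hφ hΦ m l]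
    change _ = (2⁻¹ : 𝕜) * _ + (2⁻¹ : 𝕜) * _
    rw [← add_mul, ← two_mul, mul_inv_cancel₀ two_ne_zero, one_mul]
    rfl
  rw [h1]
  simp [jetTwo_ofReal, hφ.lieDeriv_lieDeriv_mul_one, mul_add, Finset.sum_add_distrib,
    apply_ite (algebraMap ℝ 𝕜)]

/-- Functions vanishing to second order at the identity are their own Taylor remainder. -/
lemma taylor_eq_zero {f : CbTwo 𝕜 b} (h0 : f 1 = 0) (h1 : ∀ j, lieDeriv (b j) f 1 = 0)
    (h2 : ∀ j k, lieDeriv (b j) (lieDeriv (b k) f) 1 = 0) : taylor 𝕜 b φ Φ f = 0 := by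
  have hone : taylorOne 𝕜 b φ Φ f = 0 := by
    simp [taylorOne_apply, jetZero_apply, jetOne_apply, h0, h1]
  simp [taylor_apply, hone, taylorCoeff, jetTwo_apply, h2]

variable (𝕜 b φ Φ) in
lemma exists_taylor_bound : ∃ A : ℝ, 0 ≤ A ∧ ∀ f : CbTwo 𝕜 b,
    (∀ j k, ‖taylorCoeff 𝕜 b φ Φ j k f‖ ≤ A * ‖f‖) ∧ ‖taylorRem 𝕜 b φ Φ f‖ ≤ A * ‖f‖ := by
  let ι := TestFun.toCbTwoₗ (𝕜 := 𝕜) b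
  set A₁ : ℝ := 1 + (‖ι (Φ.ofReal 𝕜)‖ + ∑ j, ‖ι ((φ j).ofReal 𝕜)‖) with hA₁
  have hA₁0 : 0 ≤ A₁ := by positivity
  have hone : ∀ f : CbTwo 𝕜 b, ‖f - ι (taylorOne 𝕜 b φ Φ f)‖ ≤ A₁ * ‖f‖ := fun f => by
    refine (norm_sub_le _ _).trans ?_
    rw [hA₁, add_mul, one_mul, taylorOne_apply, map_add, map_sum, map_smul]
    gcongr
    refine (norm_add_le _ _).trans ?_
    rw [add_mul, Finset.sum_mul]
    gcongr
    · rw [norm_smul, mul_comm]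
      gcongr
      exact norm_jetZero_le f
    · refine norm_sum_le_of_le _ fun j _ => ?_
      rw [map_smul, norm_smul, mul_comm]
      gcongr
      exact norm_jetOne_le j f
  have hcoeff : ∀ (f : CbTwo 𝕜 b) j k, ‖taylorCoeff 𝕜 b φ Φ j k f‖ ≤ A₁ * ‖f‖ := fun f j k => by
    have h1 : ‖taylorCoeff 𝕜 b φ Φ j k f‖
        = 2⁻¹ * ‖jetTwo 𝕜 b j k (f - ι (taylorOne 𝕜 b φ Φ f))‖ := by
      change ‖(2⁻¹ : 𝕜) * _‖ = _
      rw [norm_mul, norm_inv, RCLike.norm_ofNat]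
      rfl
    rw [h1]
    have h2 := (norm_jetTwo_le j k (f - ι (taylorOne 𝕜 b φ Φ f))).trans (hone f)
    have h3 := norm_nonneg (jetTwo 𝕜 b j k (f - ι (taylorOne 𝕜 b φ Φ f)))
    linarith
  refine ⟨A₁ + ∑ j, ∑ k, A₁ * ‖ι ((φ j * φ k).ofReal 𝕜)‖, by positivity, fun f =>
    ⟨fun j k => (hcoeff f j k).trans ?_, ?_⟩⟩
  · gcongr
    exact le_add_of_nonneg_right (by positivity)
  · rw [taylorRem_apply, taylor_apply, map_add, ← sub_sub, add_mul]
    refine (norm_sub_le _ _).trans (add_le_add (hone f) ?_)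
    simp only [map_sum, map_smul, Finset.sum_mul]
    refine norm_sum_le_of_le _ fun j _ => norm_sum_le_of_le _ fun k _ => ?_
    rw [norm_smul, mul_right_comm]
    gcongr
    exact hcoeff f j k

end Taylor

/-! ### Real and imaginary parts, and smooth cutoffs -/

namespace TestFun

variable {E : Type*} [NormedAddCommGroup E] [NormedSpace ℝ E]
  {G : Type*} [TopologicalSpace G] [ChartedSpace E G] {𝕜 : Type*} [RCLike 𝕜]

/-- The real part of a test function. -/
noncomputable def re (f : TestFun E G 𝕜) : TestFun E G ℝ :=
  ⟨fun x => RCLike.re (f x), (RCLike.reCLM (K := 𝕜)).contDiff.contMDiff.comp f.2.1,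
    f.2.2.comp_left (g := fun z : 𝕜 => RCLike.re z) (map_zero _)⟩

/-- The imaginary part of a test function. -/
noncomputable def im (f : TestFun E G 𝕜) : TestFun E G ℝ :=
  ⟨fun x => RCLike.im (f x), (RCLike.imCLM (K := 𝕜)).contDiff.contMDiff.comp f.2.1,
    f.2.2.comp_left (g := fun z : 𝕜 => RCLike.im z) (map_zero _)⟩

lemma ofReal_re_add_I_smul_ofReal_im (f : TestFun E G 𝕜) :
    f.re.ofReal 𝕜 + (RCLike.I : 𝕜) • f.im.ofReal 𝕜 = f := by
  refine Subtype.ext (funext fun x => ?_)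
  change (RCLike.re (f x) : 𝕜) + (RCLike.I : 𝕜) * (RCLike.im (f x) : 𝕜) = f x
  rw [mul_comm, RCLike.re_add_im]

lemma ofReal_add (f g : TestFun E G ℝ) : (f + g).ofReal 𝕜 = f.ofReal 𝕜 + g.ofReal 𝕜 :=
  Subtype.ext (funext fun x => RCLike.ofReal_add (f x) (g x))

lemma ofReal_smul (c : ℝ) (f : TestFun E G ℝ) : (c • f).ofReal 𝕜 = (c : 𝕜) • f.ofReal 𝕜 :=
  Subtype.ext (funext fun x => RCLike.ofReal_mul c (f x))

/-- The real linear functional `f ↦ Re ⟨P, f⟩` on real test functions. -/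
noncomputable def reFunctional (P : TestFun E G 𝕜 →ₗ[𝕜] 𝕜) : TestFun E G ℝ →ₗ[ℝ] ℝ where
  toFun f := RCLike.re (P (f.ofReal 𝕜))
  map_add' f g := by rw [ofReal_add, map_add, map_add]
  map_smul' c f := by
    rw [ofReal_smul, map_smul, smul_eq_mul, RCLike.re_ofReal_mul]
    rfl

lemma reFunctional_apply (P : TestFun E G 𝕜 →ₗ[𝕜] 𝕜) (f : TestFun E G ℝ) :
    reFunctional P f = RCLike.re (P (f.ofReal 𝕜)) := rfl

lemma exists_eq_one_on_isCompact [IsManifold 𝓘(ℝ, E) ∞ G] [FiniteDimensional ℝ E]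
    [T2Space G] [SecondCountableTopology G] {K : Set G} (hK : IsCompact K) :
    ∃ χ : TestFun E G ℝ, (∀ x, 0 ≤ χ x ∧ χ x ≤ 1) ∧ ∀ x ∈ K, χ x = 1 := by
  have : LocallyCompactSpace G := Manifold.locallyCompact_of_finiteDimensional 𝓘(ℝ, E)
  obtain ⟨K', hK', hKK'⟩ := exists_compact_superset hK
  obtain ⟨f, hf1, hf0, hf⟩ := exists_contMDiffMap_one_nhds_of_subset_interior (n := ⊤) 𝓘(ℝ, E)
    hK.isClosed hKK'
  exact ⟨⟨f, f.contMDiff, HasCompactSupport.intro hK' hf0⟩, fun x => hf x,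
    fun x hx => hf1.self_of_nhdsSet x hx⟩

end TestFun

/-! ### The Lévy measure -/

open CompactlySupported

variable (G : Type*) [TopologicalSpace G] in
/-- The cone of nonnegative functions. -/
def nonnegCone : PointedCone ℝ C_c(G, ℝ) where
  carrier := {u | ∀ x, 0 ≤ u x}
  add_mem' hu hv x := add_nonneg (hu x) (hv x)
  zero_mem' _ := le_rfl
  smul_mem' c _ hu x := mul_nonneg c.2 (hu x)

section HuntQuotients

variable {E : Type*} [NormedAddCommGroup E] [NormedSpace ℝ E]
  {G : Type*} [TopologicalSpace G] [ChartedSpace E G] {Φ : TestFun E G ℝ}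

variable (Φ) in
/-- The compactly supported continuous functions `u` for which `(1 - Φ) u` is smooth. Besides the
test functions these are the quotients `h / (1 - Φ)`, for test functions `h` that vanish to second
order at the identity. -/
def huntQuotients : Submodule ℝ C_c(G, ℝ) where
  carrier := {u | ContMDiff 𝓘(ℝ, E) 𝓘(ℝ, ℝ) ∞ fun x => (1 - Φ x) * u x}
  add_mem' {u v} hu hv := by
    have h := ContMDiff.add hu hv
    refine h.congr fun x => ?_
    simp [mul_add]
  zero_mem' := by
    simpa using contMDiff_const
  smul_mem' c u hu := by
    have hc : ContDiff ℝ ∞ (fun y : ℝ => c • y) := contDiff_id.const_smul c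
    have h := hc.contMDiff.comp hu
    refine h.congr fun x => ?_
    simp only [CompactlySupportedContinuousMap.coe_smul, Pi.smul_apply, smul_eq_mul,
      Function.comp]
    ring

variable (Φ) in
/-- Multiplication by the Hunt function, as a map to test functions. -/
def huntMul : huntQuotients Φ →ₗ[ℝ] TestFun E G ℝ where
  toFun u := ⟨fun x => (1 - Φ x) * u.1 x, u.2, u.1.hasCompactSupport.mul_left⟩
  map_add' u v := Subtype.ext (funext fun x => mul_add (1 - Φ x) (u.1 x) (v.1 x))
  map_smul' c u := Subtype.ext (funext fun x => mul_left_comm (1 - Φ x) c (u.1 x))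

lemma mem_huntQuotients_of_testFun (χ : TestFun E G ℝ) :
    (⟨⟨χ, χ.continuous⟩, χ.2.2⟩ : C_c(G, ℝ)) ∈ huntQuotients Φ :=
  (contMDiff_const.sub Φ.2.1).mul χ.2.1

/-- The measure `(1 - Φ)⁻¹ μ`. At the identity, where `1 - Φ` vanishes, the density is `0⁻¹ = 0`,
so that the identity carries no mass. -/
noncomputable def huntMeasure [MeasurableSpace G] (Φ : TestFun E G ℝ) (μ : Measure G) : Measure G :=
  μ.withDensity fun x => ENNReal.ofReal (1 - Φ x)⁻¹

lemma measurable_huntDensity [MeasurableSpace G] [BorelSpace G] (Φ : TestFun E G ℝ) :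
    Measurable fun x => ENNReal.ofReal (1 - Φ x)⁻¹ :=
  ((Φ.continuous.measurable.const_sub 1).inv).ennreal_ofReal

end HuntQuotients

section Levy

variable {E : Type*} [NormedAddCommGroup E] [NormedSpace ℝ E]
  {G : Type*} [TopologicalSpace G] [ChartedSpace E G] [Group G]
  {𝕜 : Type*} [RCLike 𝕜] {d : ℕ} {b : Module.Basis (Fin d) ℝ (GroupLieAlgebra 𝓘(ℝ, E) G)}
  {φ : Fin d → TestFun E G ℝ} {Φ : TestFun E G ℝ} {P : TestFun E G 𝕜 →ₗ[𝕜] 𝕜}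

lemma IsDissipative.reFunctional_nonneg (hP : IsDissipative b P) {f : TestFun E G ℝ}
    (hf : ∀ x, 0 ≤ f x) (hf1 : f 1 = 0) : 0 ≤ TestFun.reFunctional P f := by
  have h := (hP.nonpos (-f) fun x => by
    change -f x ≤ -f 1
    rw [hf1, neg_zero]
    exact neg_nonpos.2 (hf x)).1
  rw [← TestFun.reFunctional_apply, map_neg] at h
  linarith

/-- A dissipative distribution is real on real functions dominated by the Hunt function: adding a
multiple of the cutoff produces a maximum at the identity. -/
lemma IsDissipative.im_eq_zero (hP : IsDissipative b P) (hφ : IsCoordinateSystem b φ)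
    (hΦ : IsHuntCutoff φ Φ) {g : TestFun E G ℝ} {K : ℝ} (hg : ∀ x, |g x| ≤ K * (1 - Φ x)) :
    RCLike.im (P (g.ofReal 𝕜)) = 0 := by
  have hΦ1 := hΦ.apply_one hφ
  have hg1 : g 1 = 0 := by
    have := hg 1
    rw [hΦ1, sub_self, mul_zero] at this
    exact abs_nonpos_iff.1 this
  have h1 := (hP.nonpos (g + K • Φ) fun x => by
    change g x + K * Φ x ≤ g 1 + K * Φ 1
    rw [hg1, hΦ1]
    have := (abs_le.1 (hg x)).2
    linarith).2
  have h2 := (hP.nonpos Φ fun x => hΦ1 ▸ hΦ.le_one x).2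
  rw [TestFun.ofReal_add, TestFun.ofReal_smul, map_add, map_smul, map_add, smul_eq_mul,
    RCLike.im_ofReal_mul, h2, mul_zero, add_zero] at h1
  exact h1

/-- If `0 ≤ χ ≤ 1`, then `(1 - Φ) χ + Φ` attains its maximum at the identity. -/
lemma IsDissipative.reFunctional_le (hP : IsDissipative b P) (hφ : IsCoordinateSystem b φ)
    (hΦ : IsHuntCutoff φ Φ) {g χ : TestFun E G ℝ} (hχ : ∀ x, χ x ≤ 1)
    (hg : ∀ x, g x = (1 - Φ x) * χ x) :
    TestFun.reFunctional P g ≤ ‖P (Φ.ofReal 𝕜)‖ := by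
  have hΦ1 := hΦ.apply_one hφ
  have h := (hP.nonpos (g + Φ) fun x => by
    change g x + Φ x ≤ g 1 + Φ 1
    rw [hg, hg, hΦ1]
    nlinarith [mul_le_mul_of_nonneg_left (hχ x) (hΦ.one_sub_nonneg x)]).1
  rw [← TestFun.reFunctional_apply, map_add, TestFun.reFunctional_apply P Φ] at h
  have h2 := (abs_le.1 (RCLike.abs_re_le_norm (P (Φ.ofReal 𝕜)))).1
  linarith

variable [LieGroup 𝓘(ℝ, E) ∞ G] [FiniteDimensional ℝ E] [T2Space G] [SecondCountableTopology G]
  [MeasurableSpace G] [BorelSpace G]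

/-- The functional `u ↦ ⟨P, (1 - Φ) u⟩` is positive, so that it is given by a measure by the
extension theorem of M. Riesz and the Riesz–Markov–Kakutani theorem. -/
lemma IsDissipative.exists_measure (hP : IsDissipative b P) (hφ : IsCoordinateSystem b φ)
    (hΦ : IsHuntCutoff φ Φ) :
    ∃ μ : Measure G, μ Set.univ ≤ ENNReal.ofReal ‖P (Φ.ofReal 𝕜)‖ ∧
      ∀ (u : C_c(G, ℝ)) (g : TestFun E G ℝ), (∀ x, g x = (1 - Φ x) * u x) →
        TestFun.reFunctional P g = ∫ x, u x ∂μ := by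
  have : LocallyCompactSpace G := Manifold.locallyCompact_of_finiteDimensional 𝓘(ℝ, E)
  have hΦ1 := hΦ.apply_one hφ
  obtain ⟨Λ, hΛ, hpos⟩ := riesz_extension (nonnegCone G)
    ⟨huntQuotients Φ, TestFun.reFunctional P ∘ₗ huntMul Φ⟩
    (fun u hu => hP.reFunctional_nonneg (f := huntMul Φ u)
      (fun x => mul_nonneg (hΦ.one_sub_nonneg x) (hu x)) (by
        change (1 - Φ 1) * u.1 1 = 0
        rw [hΦ1, sub_self, zero_mul]))
    -- Every `y` is at least `-M χ` for a bound `M` and a cutoff `χ`, a multiple of a test function.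
    (fun y => by
      obtain ⟨χ, hχ, hχ1⟩ := TestFun.exists_eq_one_on_isCompact (E := E) y.hasCompactSupport
      obtain ⟨M, hM⟩ := y.hasCompactSupport.exists_bound_of_continuous y.continuous
      refine ⟨(M • ⟨_, mem_huntQuotients_of_testFun χ⟩ : huntQuotients Φ), fun x => ?_⟩
      change 0 ≤ M * χ x + y x
      by_cases hx : x ∈ tsupport y
      · rw [hχ1 x hx]
        linarith [(abs_le.1 (hM x)).1]
      · rw [image_eq_zero_of_notMem_tsupport hx, add_zero]
        exact mul_nonneg ((norm_nonneg _).trans (hM x)) (hχ x).1)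
  let L : C_c(G, ℝ) →ₚ[ℝ] ℝ := PositiveLinearMap.mk₀ Λ hpos
  refine ⟨RealRMK.rieszMeasure L, ?_, fun u g hg => ?_⟩
  · rw [isOpen_univ.measure_eq_iSup_isCompact]
    refine iSup₂_le fun K _ => iSup_le fun hK => ?_
    obtain ⟨χ, hχ, hχ1⟩ := TestFun.exists_eq_one_on_isCompact (E := E) hK
    refine (RealRMK.rieszMeasure_le_of_eq_one L (f := ⟨⟨χ, χ.continuous⟩, χ.2.2⟩)
      (fun x => (hχ x).1) hK hχ1).trans (ENNReal.ofReal_le_ofReal ?_)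
    refine (hΛ ⟨_, mem_huntQuotients_of_testFun χ⟩).trans_le ?_
    exact hP.reFunctional_le hφ hΦ (fun x => (hχ x).2) fun x => rfl
  · rw [RealRMK.integral_rieszMeasure]
    have hu : u ∈ huntQuotients Φ := g.2.1.congr fun x => (hg x).symm
    have h2 : g = huntMul Φ ⟨u, hu⟩ := Subtype.ext (funext hg)
    rw [h2]
    exact (hΛ ⟨u, hu⟩).symm

end Levy

section HuntMeasure

variable {E : Type*} [NormedAddCommGroup E] [NormedSpace ℝ E]
  {G : Type*} [TopologicalSpace G] [ChartedSpace E G] [Group G]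
  {𝕜 : Type*} [RCLike 𝕜] {d : ℕ} {b : Module.Basis (Fin d) ℝ (GroupLieAlgebra 𝓘(ℝ, E) G)}
  {φ : Fin d → TestFun E G ℝ} {Φ : TestFun E G ℝ}

lemma norm_inv_smul_le (hΦ : IsHuntCutoff φ Φ) {h : G → 𝕜} {B : ℝ} (hB : 0 ≤ B)
    (hh : ∀ x, ‖h x‖ ≤ B * (1 - Φ x)) (x : G) : ‖(1 - Φ x)⁻¹ • h x‖ ≤ B := by
  have h0 := hΦ.one_sub_nonneg x
  rw [norm_smul, norm_inv, Real.norm_of_nonneg h0]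
  rcases h0.eq_or_lt with h1 | h1
  · rw [← h1, inv_zero, zero_mul]
    exact hB
  · rw [inv_mul_le_iff₀ h1, mul_comm]
    exact hh x

/-- The quotient of a function negligible at the identity by the Hunt function is continuous. -/
lemma continuous_div_hunt (hφ : IsCoordinateSystem b φ) (hΦ : IsHuntCutoff φ Φ) {g : G → ℝ}
    (hg : Continuous g) (hsmall : ∀ ε : ℝ, 0 < ε → ∀ᶠ x in 𝓝 (1 : G), |g x| ≤ ε * (1 - Φ x)) :
    Continuous fun x => (1 - Φ x)⁻¹ * g x := by
  refine continuous_iff_continuousAt.2 fun x => ?_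
  by_cases hx : x = 1
  · subst hx
    have h0 : (1 - Φ 1)⁻¹ * g 1 = 0 := by simp [hΦ.apply_one hφ]
    rw [ContinuousAt, h0, Metric.tendsto_nhds]
    intro ε hε
    filter_upwards [hsmall (ε / 2) (by positivity)] with x hx
    have h1 := hΦ.one_sub_nonneg x
    rw [dist_zero_right, norm_mul, norm_inv, Real.norm_of_nonneg h1]
    rcases h1.eq_or_lt with h2 | h2
    · rw [← h2, inv_zero, zero_mul]
      exact hε
    · rw [inv_mul_lt_iff₀ h2, Real.norm_eq_abs]
      nlinarith
  · exact ((continuousAt_const.sub Φ.continuous.continuousAt).inv₀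
      (hΦ.one_sub_pos hx).ne').mul hg.continuousAt

variable [MeasurableSpace G] [BorelSpace G] {μ : Measure G}

lemma huntMeasure_one [T2Space G] (hφ : IsCoordinateSystem b φ) (hΦ : IsHuntCutoff φ Φ) :
    huntMeasure Φ μ {1} = 0 := by
  rw [huntMeasure, withDensity_apply _ (measurableSet_singleton 1),
    setLIntegral_congr_fun (g := fun _ => 0) (measurableSet_singleton 1), lintegral_zero]
  intro x hx
  rw [Set.mem_singleton_iff.1 hx]
  simp [hΦ.apply_one hφ]

lemma huntMeasure_compl_lt_top (hΦ : IsHuntCutoff φ Φ) [IsFiniteMeasure μ] {U : Set G}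
    (hU : IsOpen U) (h1 : 1 ∈ U) : huntMeasure Φ μ Uᶜ < ⊤ := by
  obtain ⟨ε, hε, h⟩ := hΦ.exists_pos_le (hU.mem_nhds h1)
  rw [huntMeasure, withDensity_apply _ hU.measurableSet.compl]
  refine (setLIntegral_mono (g := fun _ => ENNReal.ofReal ε⁻¹) measurable_const fun x hx =>
    ENNReal.ofReal_le_ofReal (inv_anti₀ hε (h x hx))).trans_lt ?_
  refine (setLIntegral_const _ _).trans_lt ?_
  exact ENNReal.mul_lt_top ENNReal.ofReal_lt_top (measure_lt_top μ _)

lemma integral_huntMeasure (hΦ : IsHuntCutoff φ Φ) (h : G → 𝕜) :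
    ∫ x, h x ∂huntMeasure Φ μ = ∫ x, (1 - Φ x)⁻¹ • h x ∂μ := by
  rw [huntMeasure, integral_withDensity_eq_integral_toReal_smul (measurable_huntDensity Φ)
    (Eventually.of_forall fun x => ENNReal.ofReal_lt_top)]
  refine integral_congr_ae (Eventually.of_forall fun x => ?_)
  simp only
  rw [ENNReal.toReal_ofReal (inv_nonneg.2 (hΦ.one_sub_nonneg x))]

lemma integrable_huntMeasure (hΦ : IsHuntCutoff φ Φ) [IsFiniteMeasure μ] {h : G → 𝕜} {B : ℝ}
    (hB : 0 ≤ B) (hc : Measurable h) (hh : ∀ x, ‖h x‖ ≤ B * (1 - Φ x)) :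
    Integrable h (huntMeasure Φ μ) := by
  rw [huntMeasure, integrable_withDensity_iff_integrable_smul' (measurable_huntDensity Φ)
    (Eventually.of_forall fun x => ENNReal.ofReal_lt_top)]
  refine Integrable.of_bound
    ((measurable_huntDensity Φ).ennreal_toReal.smul hc).aestronglyMeasurable B
    (Eventually.of_forall fun x => ?_)
  rw [ENNReal.toReal_ofReal (inv_nonneg.2 (hΦ.one_sub_nonneg x))]
  exact norm_inv_smul_le hΦ hB hh x

lemma norm_integral_huntMeasure_le (hΦ : IsHuntCutoff φ Φ) {h : G → 𝕜} {B m : ℝ}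
    (hB : 0 ≤ B) (hm : 0 ≤ m) (hμ : μ Set.univ ≤ ENNReal.ofReal m)
    (hh : ∀ x, ‖h x‖ ≤ B * (1 - Φ x)) : ‖∫ x, h x ∂huntMeasure Φ μ‖ ≤ B * m := by
  have : IsFiniteMeasure μ := ⟨hμ.trans_lt ENNReal.ofReal_lt_top⟩
  rw [integral_huntMeasure hΦ]
  refine (norm_integral_le_of_norm_le_const
    (Eventually.of_forall (norm_inv_smul_le hΦ hB hh))).trans ?_
  gcongr
  exact ENNReal.toReal_le_of_le_ofReal hm hμ

end HuntMeasure

section Representation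

variable {E : Type*} [NormedAddCommGroup E] [NormedSpace ℝ E] [FiniteDimensional ℝ E]
  {G : Type*} [TopologicalSpace G] [ChartedSpace E G] [Group G] [LieGroup 𝓘(ℝ, E) ∞ G]
  {𝕜 : Type*} [RCLike 𝕜] {d : ℕ} {b : Module.Basis (Fin d) ℝ (GroupLieAlgebra 𝓘(ℝ, E) G)}
  {φ : Fin d → TestFun E G ℝ} {Φ : TestFun E G ℝ} {P : TestFun E G 𝕜 →ₗ[𝕜] 𝕜}

variable [MeasurableSpace G] [BorelSpace G]

/-- On test functions vanishing to second order at the identity the distribution is integration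
against the Lévy measure. -/
lemma IsDissipative.eq_integral (hP : IsDissipative b P) (hφ : IsCoordinateSystem b φ)
    (hΦ : IsHuntCutoff φ Φ) {μ : Measure G} [IsFiniteMeasure μ]
    (hμ : ∀ (u : CompactlySupportedContinuousMap G ℝ) (g : TestFun E G ℝ),
      (∀ x, g x = (1 - Φ x) * u x) → TestFun.reFunctional P g = ∫ x, u x ∂μ)
    (h : TestFun E G 𝕜) (h0 : h 1 = 0) (h1 : ∀ j, lieDeriv (b j) h 1 = 0)
    (h2 : ∀ j k, lieDeriv (b j) (lieDeriv (b k) h) 1 = 0) :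
    P h = ∫ x, h x ∂huntMeasure Φ μ := by
  obtain ⟨K, hK, hbound⟩ := exists_norm_le_hunt 𝕜 hφ hΦ
  have hB := hbound (h.toCbTwo b) h0 h1
  have hB0 : 0 ≤ K * ‖h.toCbTwo b‖ := by positivity
  have hsmall : ∀ ε : ℝ, 0 < ε → ∀ᶠ x in 𝓝 (1 : G), ‖h x‖ ≤ ε * (1 - Φ x) := fun ε hε =>
    eventually_norm_le_hunt hφ hΦ (h.toCbTwo b).2.1 h0 h1 h2 hε
  have key : ∀ g : TestFun E G ℝ, (∀ x, |g x| ≤ ‖h x‖) →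
      P (g.ofReal 𝕜) = ((∫ x, g x ∂huntMeasure Φ μ : ℝ) : 𝕜) := by
    intro g hg
    have him := hP.im_eq_zero hφ hΦ fun x => (hg x).trans (hB x)
    have hcont := continuous_div_hunt hφ hΦ g.continuous fun ε hε =>
      (hsmall ε hε).mono fun x hx => (hg x).trans hx
    have hre := hμ ⟨⟨_, hcont⟩, g.2.2.mul_left⟩ g fun x => by
      change g x = (1 - Φ x) * ((1 - Φ x)⁻¹ * g x)
      by_cases hx : x = 1
      · subst hx
        have : g 1 = 0 := by
          have := hg 1
          rw [h0, norm_zero] at this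
          exact abs_nonpos_iff.1 this
        simp [this]
      · rw [mul_inv_cancel_left₀ (hΦ.one_sub_pos hx).ne']
    rw [← RCLike.re_add_im (P (g.ofReal 𝕜)), him, ← TestFun.reFunctional_apply, hre,
      integral_huntMeasure hΦ]
    simp
  have hint := integrable_huntMeasure (μ := μ) hΦ hB0 h.continuous.measurable hB
  conv_lhs => rw [← h.ofReal_re_add_I_smul_ofReal_im]
  rw [map_add, map_smul, key h.re fun x => RCLike.abs_re_le_norm _,
    key h.im fun x => RCLike.abs_im_le_norm _, smul_eq_mul, mul_comm]
  exact integral_re_add_im hint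

end Representation

/-! ### Uniqueness of the Lévy measure -/

section Uniqueness

lemma sigmaFinite_of_compl_lt_top {X : Type*} [TopologicalSpace X] [T1Space X]
    [FirstCountableTopology X] [MeasurableSpace X] {x : X} {ν : Measure X}
    (hx : ν {x} < ⊤) (hν : ∀ U : Set X, IsOpen U → x ∈ U → ν Uᶜ < ⊤) : SigmaFinite ν := by
  obtain ⟨U, hU, hxU⟩ := isGδ_iff_eq_iInter_nat.1 (IsGδ.singleton x)
  have hmem : ∀ n, x ∈ U n := Set.mem_iInter.1 (hxU ▸ Set.mem_singleton x)
  refine Measure.sigmaFinite_of_countable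
    (S := insert {x} (Set.range fun n => (U n)ᶜ)) ((Set.countable_range _).insert _) ?_ ?_
  · rintro s (rfl | ⟨n, rfl⟩)
    · exact hx
    · exact hν _ (hU n) (hmem n)
  · rw [Set.sUnion_insert, Set.sUnion_range, ← Set.compl_iInter, ← hxU, Set.union_compl_self]

/-- Two measures without mass at `x`, finite off every neighbourhood of `x`, are equal if they
integrate alike all test functions supported away from `x`. Their densities with respect to the
sum are compared by the fundamental lemma of the calculus of variations. -/
lemma measure_eq_of_integral_testFun_eq {E : Type*} [NormedAddCommGroup E] [NormedSpace ℝ E]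
    [FiniteDimensional ℝ E] {G : Type*} [TopologicalSpace G] [ChartedSpace E G]
    [IsManifold 𝓘(ℝ, E) ∞ G] [T2Space G] [SecondCountableTopology G] [MeasurableSpace G]
    [BorelSpace G] {x : G} {ν ν' : Measure G} (hx : ν {x} = 0) (hx' : ν' {x} = 0)
    (hν : ∀ U : Set G, IsOpen U → x ∈ U → ν Uᶜ < ⊤)
    (hν' : ∀ U : Set G, IsOpen U → x ∈ U → ν' Uᶜ < ⊤)
    (h : ∀ g : TestFun E G ℝ, tsupport g ⊆ {x}ᶜ → ∫ y, g y ∂ν = ∫ y, g y ∂ν') : ν = ν' := by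
  have : LocallyCompactSpace G := Manifold.locallyCompact_of_finiteDimensional 𝓘(ℝ, E)
  have : SigmaFinite ν := sigmaFinite_of_compl_lt_top (by simp [hx]) hν
  have : SigmaFinite ν' := sigmaFinite_of_compl_lt_top (by simp [hx']) hν'
  have hac : ν ≪ ν + ν' := Measure.absolutelyContinuous_of_le (Measure.le_add_right le_rfl)
  have hac' : ν' ≪ ν + ν' := Measure.absolutelyContinuous_of_le (Measure.le_add_left le_rfl)
  have hloc : ∀ η : Measure G, (∀ U : Set G, IsOpen U → x ∈ U → η Uᶜ < ⊤) →
      LocallyIntegrableOn (fun y => (η.rnDeriv (ν + ν') y).toReal) {x}ᶜ (ν + ν') := by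
    intro η hη y hy
    obtain ⟨V, W, hV, hW, hyV, hxW, hVW⟩ := t2_separation (show y ≠ x from hy)
    refine ⟨V, mem_nhdsWithin_of_mem_nhds (hV.mem_nhds hyV), ?_⟩
    refine Measure.integrableOn_toReal_rnDeriv (ne_of_lt ?_)
    exact (measure_mono (Set.subset_compl_iff_disjoint_right.2 hVW)).trans_lt (hη W hW hxW)
  have hint : ∀ g : G → ℝ, ContMDiff 𝓘(ℝ, E) 𝓘(ℝ, ℝ) ∞ g → HasCompactSupport g →
      tsupport g ⊆ {x}ᶜ → ∀ η : Measure G, (∀ U : Set G, IsOpen U → x ∈ U → η Uᶜ < ⊤) →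
      Integrable g η := by
    intro g hg hgc hgx η hη
    have h1 : IntegrableOn g (tsupport g) η := by
      refine IntegrableOn.of_bound ?_ hg.continuous.aestronglyMeasurable
        (hgc.exists_bound_of_continuous hg.continuous).choose (Eventually.of_forall
          (hgc.exists_bound_of_continuous hg.continuous).choose_spec)
      have := hη (tsupport g)ᶜ (isClosed_tsupport g).isOpen_compl fun hx => hgx hx rfl
      rwa [compl_compl] at this
    exact (integrableOn_iff_integrable_of_support_subset (subset_tsupport g)).1 h1
  have hae := isOpen_compl_singleton.ae_eq_zero_of_integral_contMDiff_smul_eq_zero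
    (I := 𝓘(ℝ, E)) (μ := ν + ν')
    ((hloc ν hν).sub (hloc ν' hν')) (fun g hg hgc hgx => by
      have h1 := integral_rnDeriv_smul (f := g) hac
      have h2 := integral_rnDeriv_smul (f := g) hac'
      have i1 := (integrable_rnDeriv_smul_iff hac).2 (hint g hg hgc hgx ν hν)
      have i2 := (integrable_rnDeriv_smul_iff hac').2 (hint g hg hgc hgx ν' hν')
      have h3 := h ⟨g, hg, hgc⟩ hgx
      calc _ = ∫ y, ((ν.rnDeriv (ν + ν') y).toReal • g y
              - (ν'.rnDeriv (ν + ν') y).toReal • g y) ∂(ν + ν') := by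
            refine integral_congr_ae (Eventually.of_forall fun y => ?_)
            simp only [Pi.sub_apply, smul_eq_mul]
            ring
        _ = 0 := by
            rw [integral_sub i1 i2, h1, h2]
            exact sub_eq_zero.2 h3)
  have hnull : ∀ᵐ y ∂(ν + ν'), y ∈ ({x}ᶜ : Set G) := by
    rw [ae_iff]
    simp [hx, hx']
  have heq : ν.rnDeriv (ν + ν') =ᵐ[ν + ν'] ν'.rnDeriv (ν + ν') := by
    filter_upwards [hae, hnull, ν.rnDeriv_ne_top (ν + ν'), ν'.rnDeriv_ne_top (ν + ν')]
      with y hy hyx ht ht'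
    exact (ENNReal.toReal_eq_toReal_iff' ht ht').1 (sub_eq_zero.1 (hy hyx))
  exact (Measure.withDensity_rnDeriv_eq ν (ν + ν') hac).symm.trans
    ((withDensity_congr_ae heq).trans (Measure.withDensity_rnDeriv_eq ν' (ν + ν') hac'))

variable {E : Type*} [NormedAddCommGroup E] [NormedSpace ℝ E]
  {G : Type*} [TopologicalSpace G] [ChartedSpace E G] [Group G]
  {𝕜 : Type*} [RCLike 𝕜] {d : ℕ} {b : Module.Basis (Fin d) ℝ (GroupLieAlgebra 𝓘(ℝ, E) G)}
  {φ : Fin d → TestFun E G ℝ} {Φ : TestFun E G ℝ} {P : TestFun E G 𝕜 →ₗ[𝕜] 𝕜}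

lemma lieDeriv_eventuallyEq_zero (v : GroupLieAlgebra 𝓘(ℝ, E) G) {f : G → 𝕜} {x : G}
    (hf : f =ᶠ[𝓝 x] fun _ => 0) : lieDeriv v f =ᶠ[𝓝 x] fun _ => 0 := by
  filter_upwards [eventually_eventually_nhds.2 hf] with y hy
  have h1 : mfderiv 𝓘(ℝ, E) 𝓘(ℝ, 𝕜) f y = 0 :=
    ((hasMFDerivAt_const (0 : 𝕜) y).congr_of_eventuallyEq hy).mfderiv
  exact DFunLike.congr_fun h1 (mulInvariantVectorField v y)

variable [FiniteDimensional ℝ E] [LieGroup 𝓘(ℝ, E) ∞ G] [T2Space G] [SecondCountableTopology G]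
  [MeasurableSpace G] [BorelSpace G]

/-- An extension is determined by the distribution: a function is the sum of a test function and
a Taylor remainder, and on remainders the extension is integration against the Lévy measure,
which the distribution determines. -/
lemma IsLevyExtension.unique (hφ : IsCoordinateSystem b φ) (hΦ : IsHuntCutoff φ Φ)
    {Q Q' : CbTwo 𝕜 b →L[𝕜] 𝕜} (hQ : IsLevyExtension b P Q) (hQ' : IsLevyExtension b P Q') :
    Q' = Q := by
  obtain ⟨ν, hν1, hν, hνQ⟩ := hQ.levy
  obtain ⟨ν', hν1', hν', hνQ'⟩ := hQ'.levy
  have hνν' : ν = ν' := by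
    refine measure_eq_of_integral_testFun_eq (E := E) (x := 1) hν1 hν1' hν hν' fun g hg => ?_
    -- `g` vanishes near the identity, so both extensions integrate it.
    have h0 : (g.ofReal 𝕜 : G → 𝕜) =ᶠ[𝓝 1] fun _ => 0 := by
      have h1 : (1 : G) ∉ tsupport g := fun h => hg h rfl
      filter_upwards [notMem_tsupport_iff_eventuallyEq.1 h1] with x hx
      change ((g x : ℝ) : 𝕜) = 0
      rw [hx, Pi.zero_apply, RCLike.ofReal_zero]
    have h1 := fun j => lieDeriv_eventuallyEq_zero (b j) h0
    have h2 := fun j k => lieDeriv_eventuallyEq_zero (b j) (h1 k)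
    have e1 := (hνQ ((g.ofReal 𝕜).toCbTwo b) h0.self_of_nhds (fun j => (h1 j).self_of_nhds)
      fun j k => (h2 j k).self_of_nhds).2
    have e2 := (hνQ' ((g.ofReal 𝕜).toCbTwo b) h0.self_of_nhds (fun j => (h1 j).self_of_nhds)
      fun j k => (h2 j k).self_of_nhds).2
    rw [hQ.extends_test] at e1
    rw [hQ'.extends_test, e1] at e2
    have e3 : ((∫ y, g y ∂ν : ℝ) : 𝕜) = ((∫ y, g y ∂ν' : ℝ) : 𝕜) := by
      rw [← integral_ofReal, ← integral_ofReal]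
      exact e2
    exact_mod_cast e3
  subst hνν'
  ext f
  have hrem := fun i j => lieDeriv_lieDeriv_taylorRem_one hφ hΦ f i j
  have e1 := (hνQ _ (taylorRem_apply_one hφ hΦ f) (lieDeriv_taylorRem_one hφ hΦ f) hrem).2
  have e2 := (hνQ' _ (taylorRem_apply_one hφ hΦ f) (lieDeriv_taylorRem_one hφ hΦ f) hrem).2
  have hsplit : f = (taylor 𝕜 b φ Φ f).toCbTwo b + taylorRem 𝕜 b φ Φ f :=
    (add_sub_cancel _ _).symm
  rw [hsplit, map_add, map_add, hQ.extends_test, hQ'.extends_test, e1, e2]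

end Uniqueness

/-! ### Construction of the extension and the norm estimate -/

section Existence

variable {E : Type*} [NormedAddCommGroup E] [NormedSpace ℝ E]
  {G : Type*} [TopologicalSpace G] [ChartedSpace E G] [Group G] [LieGroup 𝓘(ℝ, E) ∞ G]
  {𝕜 : Type*} [RCLike 𝕜] {d : ℕ} {b : Module.Basis (Fin d) ℝ (GroupLieAlgebra 𝓘(ℝ, E) G)}
  {φ : Fin d → TestFun E G ℝ} {Φ : TestFun E G ℝ} {P : TestFun E G 𝕜 →ₗ[𝕜] 𝕜}

lemma norm_apply_taylor_le {A : ℝ} {f : CbTwo 𝕜 b}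
    (hA : ∀ j k, ‖taylorCoeff 𝕜 b φ Φ j k f‖ ≤ A * ‖f‖) :
    ‖P (taylor 𝕜 b φ Φ f)‖ ≤ (‖P (Φ.ofReal 𝕜)‖ + ∑ j, ‖P ((φ j).ofReal 𝕜)‖
      + A * ∑ j, ∑ k, ‖P ((φ j * φ k).ofReal 𝕜)‖) * ‖f‖ := by
  simp only [taylor_apply, taylorOne_apply, map_add, map_sum, map_smul, smul_eq_mul, add_mul,
    Finset.sum_mul, Finset.mul_sum]
  refine norm_add₃_le.trans (add_le_add_three ?_ ?_ ?_)
  · rw [norm_mul, mul_comm]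
    gcongr
    exact norm_jetZero_le f
  · refine norm_sum_le_of_le _ fun j _ => ?_
    rw [norm_mul, mul_comm]
    gcongr
    exact norm_jetOne_le j f
  · refine norm_sum_le_of_le _ fun j _ => norm_sum_le_of_le _ fun k _ => ?_
    rw [norm_mul, mul_right_comm]
    gcongr
    exact hA j k

variable [FiniteDimensional ℝ E] [T2Space G] [SecondCountableTopology G]
  [MeasurableSpace G] [BorelSpace G]

/-- The extension is `f ↦ ⟨P, T f⟩ + ∫ R f dν` for the Taylor expansion `T f` and its remainder
`R f`. The integral is controlled by `|⟨P, Φ⟩|`, which bounds the mass of `(1 - Φ) ν`. -/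
lemma exists_levyExtension_norm_le (𝕜 : Type*) [RCLike 𝕜] (hφ : IsCoordinateSystem b φ)
    (hΦ : IsHuntCutoff φ Φ) :
    ∃ C : ℝ, 0 < C ∧ ∀ P : TestFun E G 𝕜 →ₗ[𝕜] 𝕜, IsDissipative b P →
      ∃ Q : CbTwo 𝕜 b →L[𝕜] 𝕜, IsLevyExtension b P Q ∧
        ‖Q‖ ≤ C * (‖P (Φ.ofReal 𝕜)‖ + ∑ j, ∑ k, ‖P ((φ j * φ k).ofReal 𝕜)‖
          + ∑ j, ‖P ((φ j).ofReal 𝕜)‖) := by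
  obtain ⟨A, hA0, hA⟩ := exists_taylor_bound 𝕜 b φ Φ
  obtain ⟨K, hK0, hK⟩ := exists_norm_le_hunt 𝕜 hφ hΦ
  refine ⟨1 + A + K * A, by positivity, fun P hP => ?_⟩
  obtain ⟨μ, hμ, hPμ⟩ := hP.exists_measure hφ hΦ
  have : IsFiniteMeasure μ := ⟨hμ.trans_lt ENNReal.ofReal_lt_top⟩
  have hrem : ∀ (f : CbTwo 𝕜 b) (x : G),
      ‖taylorRem 𝕜 b φ Φ f x‖ ≤ K * ‖taylorRem 𝕜 b φ Φ f‖ * (1 - Φ x) := fun f =>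
    hK _ (taylorRem_apply_one hφ hΦ f) (lieDeriv_taylorRem_one hφ hΦ f)
  have hint : ∀ f : CbTwo 𝕜 b, Integrable (taylorRem 𝕜 b φ Φ f) (huntMeasure Φ μ) := fun f =>
    integrable_huntMeasure hΦ (by positivity)
      (taylorRem 𝕜 b φ Φ f).2.1.continuous.measurable (hrem f)
  obtain ⟨L, hLdef⟩ : ∃ L : CbTwo 𝕜 b →ₗ[𝕜] 𝕜, ∀ f, L f
      = P (taylor 𝕜 b φ Φ f) + ∫ x, taylorRem 𝕜 b φ Φ f x ∂huntMeasure Φ μ := ⟨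
    { toFun := fun f => P (taylor 𝕜 b φ Φ f) + ∫ x, taylorRem 𝕜 b φ Φ f x ∂huntMeasure Φ μ
      map_add' := fun f g => by
        have h := integral_add (hint f) (hint g)
        simp only [map_add]
        rw [add_add_add_comm, ← h]
        rfl
      map_smul' := fun c f => by
        have h := integral_const_mul (μ := huntMeasure Φ μ) c (taylorRem 𝕜 b φ Φ f)
        simp only [map_smul, RingHom.id_apply, smul_eq_mul]
        rw [mul_add]
        exact congrArg _ h }, fun f => rfl⟩
  have hL : ∀ f, ‖L f‖ ≤ (1 + A + K * A) * (‖P (Φ.ofReal 𝕜)‖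
      + ∑ j, ∑ k, ‖P ((φ j * φ k).ofReal 𝕜)‖ + ∑ j, ‖P ((φ j).ofReal 𝕜)‖) * ‖f‖ := by
    intro f
    have h1 := norm_apply_taylor_le (P := P) (hA f).1
    have h2 := norm_integral_huntMeasure_le (h := taylorRem 𝕜 b φ Φ f) hΦ (by positivity)
      (norm_nonneg _) hμ (hrem f)
    rw [hLdef]
    refine (norm_add_le _ _).trans ((add_le_add h1 h2).trans ?_)
    have h3 : K * ‖taylorRem 𝕜 b φ Φ f‖ * ‖P (Φ.ofReal 𝕜)‖
        ≤ K * (A * ‖f‖) * ‖P (Φ.ofReal 𝕜)‖ := by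
      gcongr
      exact (hA f).2
    refine (add_le_add_right h3 _).trans ?_
    have p : 0 ≤ ‖P (Φ.ofReal 𝕜)‖ := norm_nonneg _
    have q : 0 ≤ ∑ j, ∑ k, ‖P ((φ j * φ k).ofReal 𝕜)‖ := by positivity
    have r : 0 ≤ ∑ j, ‖P ((φ j).ofReal 𝕜)‖ := by positivity
    generalize ‖P (Φ.ofReal 𝕜)‖ = p' at *
    generalize ∑ j, ∑ k, ‖P ((φ j * φ k).ofReal 𝕜)‖ = q' at *
    generalize ∑ j, ‖P ((φ j).ofReal 𝕜)‖ = r' at *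
    calc _ = (p' + r' + A * q' + K * A * p') * ‖f‖ := by ring
      _ ≤ _ := by
        gcongr
        nlinarith [mul_nonneg hA0 p, mul_nonneg hA0 r, mul_nonneg (mul_nonneg hK0 hA0) q,
          mul_nonneg (mul_nonneg hK0 hA0) r]
  refine ⟨L.mkContinuous _ hL, ⟨fun f => ?_, huntMeasure Φ μ, huntMeasure_one hφ hΦ,
    fun U hU h1 => huntMeasure_compl_lt_top hΦ hU h1, fun f h0 h1 h2 => ?_⟩,
    L.mkContinuous_norm_le (by positivity) hL⟩
  · let h : TestFun E G 𝕜 := f - taylor 𝕜 b φ Φ (f.toCbTwo b)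
    have hfun : (taylorRem 𝕜 b φ Φ (f.toCbTwo b) : G → 𝕜) = h := rfl
    have h0 := taylorRem_apply_one hφ hΦ (f.toCbTwo b)
    have h1 := lieDeriv_taylorRem_one hφ hΦ (f.toCbTwo b)
    have h2 := lieDeriv_lieDeriv_taylorRem_one hφ hΦ (f.toCbTwo b)
    have h3 := hLdef (f.toCbTwo b)
    rw [hfun] at h0 h1 h2 h3
    refine h3.trans ?_
    rw [← hP.eq_integral hφ hΦ hPμ h h0 h1 h2, ← map_add, add_sub_cancel]
  · have hT : taylor 𝕜 b φ Φ f = 0 := taylor_eq_zero h0 h1 h2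
    have hR : taylorRem 𝕜 b φ Φ f = f := by
      rw [taylorRem_apply, hT, map_zero, sub_zero]
    refine ⟨hR ▸ hint f, ?_⟩
    refine (hLdef f).trans ?_
    rw [hT, hR, map_zero, zero_add]

end Existence

end LieDissipative

theorem proposition2p2
    {𝕜 : Type*} [RCLike 𝕜]
    {E : Type*} [NormedAddCommGroup E] [NormedSpace ℝ E] [FiniteDimensional ℝ E]
    {G : Type*} [TopologicalSpace G] [ChartedSpace E G] [Group G] [LieGroup 𝓘(ℝ, E) ∞ G]
    [T2Space G] [SecondCountableTopology G] [MeasurableSpace G] [BorelSpace G]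
    {d : ℕ} (b : Module.Basis (Fin d) ℝ (GroupLieAlgebra 𝓘(ℝ, E) G))
    (φ : Fin d → LieDissipative.TestFun E G ℝ) (hφ : LieDissipative.IsCoordinateSystem b φ)
    (Φ : LieDissipative.TestFun E G ℝ) (hΦ : LieDissipative.IsHuntCutoff φ Φ) :
    ∃ C : ℝ, 0 < C ∧ ∀ P : LieDissipative.TestFun E G 𝕜 →ₗ[𝕜] 𝕜,
      LieDissipative.IsDissipative b P →
        ∃ Q : LieDissipative.CbTwo 𝕜 b →L[𝕜] 𝕜,
          LieDissipative.IsLevyExtension b P Q ∧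
          (∀ Q' : LieDissipative.CbTwo 𝕜 b →L[𝕜] 𝕜,
            LieDissipative.IsLevyExtension b P Q' → Q' = Q) ∧
          ‖Q‖ ≤ C * (‖P (Φ.ofReal 𝕜)‖ + ∑ j, ∑ k, ‖P ((φ j * φ k).ofReal 𝕜)‖
            + ∑ j, ‖P ((φ j).ofReal 𝕜)‖ + ‖Q 1‖) := by
  obtain ⟨C, hC, h⟩ := LieDissipative.exists_levyExtension_norm_le 𝕜 hφ hΦ
  refine ⟨C, hC, fun P hP => ?_⟩
  obtain ⟨Q, hQ, hnorm⟩ := h P hP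
  refine ⟨Q, hQ, fun Q' hQ' => hQ.unique hφ hΦ hQ', hnorm.trans ?_⟩
  exact mul_le_mul_of_nonneg_left (le_add_of_nonneg_right (norm_nonneg _)) hC.le
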